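/- \textbf{Setting.} Let $A$ be a finite-dimensional real alternative $^*$-algebra with unit $1\neq 0$ ($\mathbb R$ is identified with $\mathbb R\cdot 1$, and the involution $x\mapsto x^c$ is a real linear involutive anti-automorphism). Put $t(x)=x+x^c$, $n(x)=xx^c$, $\mathbb S_A=\{x\in A: t(x)=0,\ n(x)=1\}$, assumed non-empty, $\mathbb C_J=\mathbb R+\mathbb RJ$ for $J\in\mathbb S_A$, and $Q_A=\mathbb R\cup\{x\in A: t(x),n(x)\in\mathbb R,\ t(x)^2<4n(x)\}=\bigcup_{J\in\mathbb S_A}\mathbb C_J$. Assume that $A$ carries a norm with $\|x\|^2=n(x)$ for all $x\in Q_A$, and its Euclidean topology. A $^*$-algebra is \emph{nonsingular} if $n(x)=0$ implies $x=0$. For $E\subseteq\mathbb C$ let $\Omega_E=\{\alpha+\beta J:\alpha,\beta\in\mathbb R,\ \alpha+i\beta\in E,\ J\in\mathbb S_A\}$; sets of this form are called \emph{circular}, and ``open'' means open in $Q_A$. A \emph{slice domain} is an open set $\Omega_D$ with $D\subseteq\mathbb C$ open, connected, invariant under conjugation and meeting $\mathbb R$. Let $A_{\mathbb C}=A+\imath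 A$ be the complexification of $A$, with $\overline{x+\imath y}=x-\imath y$ and $(x+\imath y)^c=x^c+\imath y^c$. For $D\ne\emptyset$ invariant under conjugation, a \emph{stem function} is a map $F=F_1+\imath F_2:D\to A_{\mathbb C}$ with $F(\bar z)=\overline{F(z)}$; it induces the \emph{slice function} $f=\mathcal I(F):\Omega_D\to A$, $f(\alpha+\beta J)=F_1(\alpha+i\beta)+JF_2(\alpha+i\beta)$. The \emph{slice product} and the \emph{slice conjugate} are $\mathcal I(F)\cdot\mathcal I(G)=\mathcal I(FG)$ and $\mathcal I(F)^c=\mathcal I(F^c)$, where $F^c(z)=F(z)^c$. If $\Omega_D$ is open, $f=\mathcal I(F)$ is \emph{slice regular} if $F$ is $C^1$ and $\frac12\left(\frac{\partial F}{\partial\alpha}+\imath\frac{\partial F}{\partial\beta}\right)=0$ on $D$. For $x,y\in Q_A$ let $\sigma(x,y)=\tau(x,y)=\|x-y\|$ if $x,y$ lie in a common $\mathbb C_J$; otherwise let $\sigma(x,y)$ and $\tau(x,y)$ be $\sqrt{(\mathrm{Re}\,x-\mathrm{Re}\,y)^2+(\|\mathrm{Im}\,x\|\pm\|\mathrm{Im}\,y\|)^2}$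 with sign $+$ and $-$ respectively, where $\mathrm{Re}\,x=\frac12(x+x^c)$, $\mathrm{Im}\,x=\frac12(x-x^c)$. Let $\Sigma(y,0,R)=\{x\in Q_A:\tau(x,y)>0,\ \sigma(x,y)<R\}$. A point $y\in Q_A$ is a \emph{singularity} of a slice regular function $f$ on a circular open set $\Omega'$ if $\Sigma(y,0,R)\subseteq\Omega'$ for some $R>0$; then, for some such $R$, $f$ has on $\Sigma(y,0,R)$ a unique Laurent expansion $f(x)=\sum_{n\in\mathbb Z}(x-y)^{\bullet n}\cdot a_n$ with $a_n\in A$, powers and products being taken with respect to the slice product. The singularity $y$ is a \emph{pole} if $a_n=0$ for all but finitely many $n<0$, and it is \emph{removable} if $f$ extends to a slice regular function on a circular open set containing $y$. Let $\Omega$ be a non-empty circular open subset of $Q_A$. A \emph{semiregular function} on $\Omega$ is a slice regular function $f$ on a circular open subset $\Omega'\subseteq\Omega$ such that every point of $\Omega\setminus\Omega'$ is a pole or a removable singularity of $f$; two of them are identified if they agree on the intersection of their domains. \textbf{Theorem.} If $f,g$ are semiregular on $\Omega$, with domains $\Omega'$ and $\Omega''$, then so are $f+g$ and the slice product $f\cdot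 g$ (both with domain $\Omega'\cap\Omega''$), and $f^c$ and $rf$ for $r\in\mathbb R$ (both with domain $\Omega'$). These operations are well defined on the set of semiregular functions on $\Omega$. With $+$, $\cdot$ and scalar multiplication this set is a real alternative algebra, whose unit is the constant function $1\neq0$, and with $f\mapsto f^c$ it is a real $^*$-algebra. This $^*$-algebra is nonsingular if and only if $A$ is nonsingular and $\Omega$ is a union of slice domains. -/

import Mathlib

open Set Filter Topology


/-! ## Finite-dimensional real alternative *-algebras -/

/-- A unital, not necessarily associative ring with a compatible norm of the underlying additive
group; no relation between the norm and the product is required. -/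
class NormedNonAssocRing (A : Type*) extends Norm A, NonAssocRing A, MetricSpace A where
  dist_eq : ∀ x y : A, dist x y = ‖-x + y‖

instance (priority := 100) NormedNonAssocRing.toNormedAddCommGroup {A : Type*}
    [h : NormedNonAssocRing A] : NormedAddCommGroup A :=
  { h with }

/-- A (unital) ring is alternative if its associator is an alternating function. -/
def IsAlternative (A : Type*) [NonAssocRing A] : Prop :=
  ∀ x y : A, associator x x y = 0 ∧ associator y x x = 0

/-- A *-algebra is nonsingular if `n(x) = x x^c = 0` only for `x = 0`. -/
def IsNonsingular (A : Type*) [NonAssocRing A] [Star A] : Prop :=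
  ∀ x : A, x * star x = 0 → x = 0

namespace SliceAlg

section Cone

variable (A : Type*) [NormedNonAssocRing A] [NormedSpace ℝ A] [StarRing A]

/-- `𝕊_A = {x | t(x) = 0, n(x) = 1}`. -/
def imagUnits : Set A := {x | x + star x = 0 ∧ x * star x = 1}

/-- The quadratic cone `Q_A = ℝ ∪ {x | t(x) ∈ ℝ, n(x) ∈ ℝ, t(x)² < 4 n(x)}`. -/
def quadraticCone : Set A :=
  {x | ∃ r : ℝ, x = r • (1 : A)} ∪
    {x | ∃ t n : ℝ, x + star x = t • (1 : A) ∧ x * star x = n • (1 : A) ∧ t ^ 2 < 4 * n}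

/-- The norm of `A` satisfies `‖x‖² = n(x)` on the quadratic cone. -/
def NormCompatible : Prop :=
  ∀ x ∈ quadraticCone A, x * star x = (‖x‖ ^ 2) • (1 : A)

variable {A}

/-- The point `α + β J` for `z = α + i β`. -/
def toSlice (J : A) (z : ℂ) : A := z.re • (1 : A) + z.im • J

/-- The plane `ℂ_J`. -/
def slicePlane (J : A) : Set A := range (toSlice J)

/-- The circularization `Ω_E` of `E ⊆ ℂ`. -/
def circularization (E : Set ℂ) : Set A :=
  {x | x ∈ quadraticCone A ∧ ∃ z ∈ E, ∃ J ∈ imagUnits A, x = toSlice J z}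

def IsCircular (Ω : Set A) : Prop := ∃ E : Set ℂ, Ω = circularization E

/-- `Ω` is a subset of the quadratic cone, open in the relative topology. -/
def IsOpenInCone (Ω : Set A) : Prop := ∃ O : Set A, IsOpen O ∧ Ω = O ∩ quadraticCone A

def ConjInvariant (D : Set ℂ) : Prop := ∀ z ∈ D, star z ∈ D

/-- A slice domain: an open circular set `Ω_D` with `D` connected, invariant under conjugation and
intersecting the real line. -/
def IsSliceDomain (Ω : Set A) : Prop :=
  IsOpenInCone Ω ∧ ∃ D : Set ℂ, IsOpen D ∧ IsConnected D ∧ ConjInvariant D ∧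
    (∃ r : ℝ, (r : ℂ) ∈ D) ∧ Ω = circularization D

def IsUnionOfSliceDomains (Ω : Set A) : Prop :=
  ∃ S : Set (Set A), (∀ s ∈ S, IsSliceDomain s) ∧ Ω = ⋃₀ S

end Cone

/-! ## The complexified algebra `A_ℂ = A + ı A` -/

@[ext] structure Cplx (A : Type*) where
  re : A
  im : A

namespace Cplx

variable {A : Type*} [NonAssocRing A]

instance : Mul (Cplx A) :=
  ⟨fun v w => ⟨v.re * w.re - v.im * w.im, v.re * w.im + v.im * w.re⟩⟩

instance : One (Cplx A) := ⟨⟨1, 0⟩⟩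

instance : Zero (Cplx A) := ⟨⟨0, 0⟩⟩

/-- Complex conjugation `x + ı y ↦ x - ı y`. -/
def conj (w : Cplx A) : Cplx A := ⟨w.re, -w.im⟩

/-- The involution `x + ı y ↦ x^c + ı y^c`. -/
instance [Star A] : Star (Cplx A) := ⟨fun w => ⟨star w.re, star w.im⟩⟩

/-- The inclusion of `A` in `A_ℂ`. -/
def ofAlg (a : A) : Cplx A := ⟨a, 0⟩

open Classical in
/-- The multiplicative inverse (unique when `A` is alternative), and `0` if there is none. -/
noncomputable def inv (w : Cplx A) : Cplx A :=
  if h : ∃ v, w * v = 1 ∧ v * w = 1 then h.choose else 0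

def npow (w : Cplx A) : ℕ → Cplx A
  | 0 => 1
  | n + 1 => npow w n * w

noncomputable def zpow (w : Cplx A) : ℤ → Cplx A
  | Int.ofNat n => npow w n
  | Int.negSucc n => npow (inv w) (n + 1)

end Cplx

section Slice

variable {A : Type*} [NormedNonAssocRing A] [NormedSpace ℝ A] [StarRing A]

/-! ## Stem functions, slice functions, slice regular functions -/

/-- `F` is a stem function on the nonempty conjugation invariant set `D`. -/
def IsStem (D : Set ℂ) (F : ℂ → Cplx A) : Prop :=
  D.Nonempty ∧ ConjInvariant D ∧ ∀ z ∈ D, F (star z) = (F z).conj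

/-- `x + ı y ↦ x + J y`. -/
def evalAt (J : A) (w : Cplx A) : A := w.re + J * w.im

/-- On `Ω = Ω_D`, the function `f` is the slice function induced by the stem function `F` on `D`.
Only the values of `f` on `Ω` and of `F` on `D` matter. -/
def Induces (Ω : Set A) (D : Set ℂ) (F : ℂ → Cplx A) (f : A → A) : Prop :=
  Ω = circularization D ∧ IsStem D F ∧
    ∀ z ∈ D, ∀ J ∈ imagUnits A, f (toSlice J z) = evalAt J (F z)

/-- On `Ω`, the function `h` is the slice product `f · g`. -/
def IsSliceProduct (Ω : Set A) (f g h : A → A) : Prop :=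
  ∃ (D : Set ℂ) (F G : ℂ → Cplx A), Induces Ω D F f ∧ Induces Ω D G g ∧
    Induces Ω D (fun z => F z * G z) h

/-- On `Ω`, the function `h` is the slice conjugate `f^c`. -/
def IsSliceConj (Ω : Set A) (f h : A → A) : Prop :=
  ∃ (D : Set ℂ) (F : ℂ → Cplx A), Induces Ω D F f ∧ Induces Ω D (fun z => star (F z)) h

/-- A stem function is continuously differentiable on `D`. -/
def IsC1 (D : Set ℂ) (F : ℂ → Cplx A) : Prop :=
  ContDiffOn ℝ 1 (fun z => (F z).re) D ∧ ContDiffOn ℝ 1 (fun z => (F z).im) D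

/-- `∂F/∂z̄ = ½ (∂F/∂α + ı ∂F/∂β)`, computed in components. -/
noncomputable def dbar (F : ℂ → Cplx A) (z : ℂ) : Cplx A :=
  ⟨(1 / 2 : ℝ) • (fderiv ℝ (fun w => (F w).re) z 1 - fderiv ℝ (fun w => (F w).im) z Complex.I),
    (1 / 2 : ℝ) • (fderiv ℝ (fun w => (F w).im) z 1 + fderiv ℝ (fun w => (F w).re) z Complex.I)⟩

/-- `f` is slice regular on the circular open set `Ω`. -/
def IsSliceRegular (Ω : Set A) (f : A → A) : Prop :=
  IsOpenInCone Ω ∧ ∃ (D : Set ℂ) (F : ℂ → Cplx A),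
    Induces Ω D F f ∧ IsC1 D F ∧ ∀ z ∈ D, dbar F z = 0

/-! ## Laurent expansions and singularities -/

noncomputable def rePart (x : A) : A := (1 / 2 : ℝ) • (x + star x)

noncomputable def imPart (x : A) : A := (1 / 2 : ℝ) • (x - star x)

/-- `x` and `y` lie in the same plane `ℂ_J`. -/
def SamePlane (x y : A) : Prop := ∃ J ∈ imagUnits A, x ∈ slicePlane J ∧ y ∈ slicePlane J

open Classical in
noncomputable def sigmaDist (x y : A) : ℝ :=
  if SamePlane x y then ‖x - y‖
  else √(‖rePart x - rePart y‖ ^ 2 + (‖imPart x‖ + ‖imPart y‖) ^ 2)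

open Classical in
noncomputable def tauDist (x y : A) : ℝ :=
  if SamePlane x y then ‖x - y‖
  else √(‖rePart x - rePart y‖ ^ 2 + (‖imPart x‖ - ‖imPart y‖) ^ 2)

/-- `Σ(y, R₁, R₂) = {x ∈ Q_A | τ_A(x, y) > R₁, σ_A(x, y) < R₂}`. -/
def sigmaAnnulus (y : A) (R₁ R₂ : ℝ) : Set A :=
  {x | x ∈ quadraticCone A ∧ R₁ < tauDist x y ∧ sigmaDist x y < R₂}

/-- `y ∈ Q_A` is a singularity for slice regular functions on `Ω`. -/
def IsSingularity (Ω : Set A) (y : A) : Prop :=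
  y ∈ quadraticCone A ∧ ∃ R > 0, sigmaAnnulus y 0 R ⊆ Ω

/-- The stem function of `(x - y)^{• n} · a`, the slice product of the `n`-th slice power of the
binomial `x - y` (which is induced by `α + i β ↦ (α - y) + ı β`) and of the constant `a`. -/
noncomputable def laurentTerm (y a : A) (n : ℤ) (z : ℂ) : Cplx A :=
  Cplx.zpow ⟨z.re • (1 : A) - y, z.im • (1 : A)⟩ n * Cplx.ofAlg a

/-- `f(x) = ∑_{n ∈ ℤ} (x - y)^{• n} · a_n` is the Laurent expansion of `f` at `y`: it is valid in
some `Σ(y, 0, R) ⊆ Ω` with `R > 0`. -/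
def HasLaurentExpansion (Ω : Set A) (f : A → A) (y : A) (a : ℤ → A) : Prop :=
  ∃ R > 0, sigmaAnnulus y 0 R ⊆ Ω ∧
    ∀ z : ℂ, ∀ J ∈ imagUnits A, toSlice J z ∈ sigmaAnnulus y 0 R →
      HasSum (fun n : ℤ => evalAt J (laurentTerm y (a n) n z)) (f (toSlice J z))

/-- `y` is a pole for the slice regular function `f` on `Ω`: only finitely many negative powers
occur in the Laurent expansion of `f` at `y`. -/
def IsPole (Ω : Set A) (f : A → A) (y : A) : Prop :=
  IsSingularity Ω y ∧ ∃ a : ℤ → A, HasLaurentExpansion Ω f y a ∧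
    ∃ m : ℕ, ∀ k : ℕ, m < k → a (-(k : ℤ)) = 0

/-- `y` is a removable singularity for the slice regular function `f` on `Ω`: `f` extends to a
slice regular function on a circular open set containing `y`. -/
def IsRemovable (Ω : Set A) (f : A → A) (y : A) : Prop :=
  IsSingularity Ω y ∧ ∃ (V : Set A) (g : A → A), IsCircular V ∧ Ω ⊆ V ∧ y ∈ V ∧
    IsSliceRegular V g ∧ EqOn g f Ω

/-! ## Semiregular functions -/

/-- A function `toFun`, slice regular on a circular open subset `dom` of `Ω`, all points of
`Ω \ dom` being poles or removable singularities. The values of `toFun` off `dom` are irrelevant. -/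
structure SemiregularRep (Ω : Set A) where
  dom : Set A
  toFun : A → A
  dom_subset : dom ⊆ Ω
  circular : IsCircular dom
  regular : IsSliceRegular dom toFun
  sing : ∀ y ∈ Ω \ dom, IsPole dom toFun y ∨ IsRemovable dom toFun y

/-! ### Semiregular functions are identified when they agree on their common domain -/

section Aux

theorem star_imagUnit {J : A} (hJ : J ∈ imagUnits A) : star J = -J :=
  (neg_eq_of_add_eq_zero_right hJ.1).symm

theorem trace_toSlice [StarModule ℝ A] {J : A} (hJ : J ∈ imagUnits A) (z : ℂ) :
    toSlice J z + star (toSlice J z) = (2 * z.re) • (1 : A) := by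
  simp only [toSlice, star_add, star_smul, star_one, star_imagUnit hJ, star_trivial]
  module

theorem norm_toSlice [StarModule ℝ A] [IsScalarTower ℝ A A] [SMulCommClass ℝ A A] {J : A}
    (hJ : J ∈ imagUnits A) (z : ℂ) :
    toSlice J z * star (toSlice J z) = (z.re ^ 2 + z.im ^ 2) • (1 : A) := by
  have h : J * J = -1 := by
    have := hJ.2
    rw [star_imagUnit hJ, mul_neg] at this
    rw [← this, neg_neg]
  simp only [toSlice, star_add, star_smul, star_one, star_imagUnit hJ, star_trivial, add_mul,
    mul_add, smul_mul_assoc, mul_smul_comm, mul_one, one_mul, mul_neg, h, smul_neg]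
  module

theorem toSlice_mem_iff [Nontrivial A] [StarModule ℝ A] [IsScalarTower ℝ A A]
    [SMulCommClass ℝ A A] {J : A} (hJ : J ∈ imagUnits A) {D : Set ℂ} (hD : ConjInvariant D)
    (z : ℂ) (h : toSlice J z ∈ (circularization D : Set A)) : z ∈ D := by
  obtain ⟨-, w, hw, K, hK, e⟩ := h
  have inj : ∀ r s : ℝ, r • (1 : A) = s • (1 : A) → r = s := fun r s h =>
    smul_left_injective ℝ (one_ne_zero (α := A)) h
  have h1 : 2 * z.re = 2 * w.re := inj _ _ (by rw [← trace_toSlice hJ, e, trace_toSlice hK])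
  have h2 : z.re ^ 2 + z.im ^ 2 = w.re ^ 2 + w.im ^ 2 :=
    inj _ _ (by rw [← norm_toSlice hJ, e, norm_toSlice hK])
  have h1' : z.re = w.re := by linarith
  rw [h1'] at h2
  rcases sq_eq_sq_iff_eq_or_eq_neg.1 (add_left_cancel h2) with h3 | h3
  · rwa [show z = w from Complex.ext h1' h3]
  · rw [show z = star w from Complex.ext (by simpa using h1') (by simpa using h3)]
    exact hD w hw

theorem continuous_toSlice (J : A) : Continuous (toSlice J) := by
  unfold toSlice
  fun_prop

theorem toSlice_mem_cone [StarModule ℝ A] [IsScalarTower ℝ A A] [SMulCommClass ℝ A A] {J : A}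
    (hJ : J ∈ imagUnits A) (z : ℂ) : toSlice J z ∈ quadraticCone A := by
  by_cases h : z.im = 0
  · exact Or.inl ⟨z.re, by simp [toSlice, h]⟩
  · refine Or.inr ⟨_, _, trace_toSlice hJ z, norm_toSlice hJ z, ?_⟩
    have : 0 < z.im ^ 2 := by positivity
    nlinarith

theorem eventually_mem [StarModule ℝ A] [IsScalarTower ℝ A A] [SMulCommClass ℝ A A] {J : A}
    (hJ : J ∈ imagUnits A) {Ω : Set A} (hΩ : IsOpenInCone Ω) {z : ℂ} (hz : toSlice J z ∈ Ω) :
    ∀ᶠ w in 𝓝 z, toSlice J w ∈ Ω := by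
  obtain ⟨O, hO, rfl⟩ := hΩ
  filter_upwards [(hO.preimage (continuous_toSlice J)).mem_nhds hz.1] with w hw
  exact ⟨hw, toSlice_mem_cone hJ w⟩

/-- A slice regular function is continuous along each slice. -/
theorem continuousAt_slice [Nontrivial A] [StarModule ℝ A] [IsScalarTower ℝ A A]
    [SMulCommClass ℝ A A] [FiniteDimensional ℝ A] {J : A} (hJ : J ∈ imagUnits A) {Ω : Set A}
    {f : A → A} (hf : IsSliceRegular Ω f) {z : ℂ} (hz : toSlice J z ∈ Ω) :
    ContinuousAt (fun w => f (toSlice J w)) z := by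
  obtain ⟨hΩ, D, F, ⟨rfl, ⟨-, hD, -⟩, hF⟩, ⟨h1, h2⟩, -⟩ := hf
  have hev : ∀ᶠ w in 𝓝 z, w ∈ D := by
    filter_upwards [eventually_mem hJ hΩ hz] with w hw using toSlice_mem_iff hJ hD w hw
  have hmul : Continuous fun x : A => J * x :=
    (LinearMap.mulLeft ℝ J).continuous_of_finiteDimensional
  have hc : ContinuousAt (fun w => evalAt J (F w)) z :=
    (h1.continuousOn.continuousAt hev).add
      (hmul.continuousAt.comp (h2.continuousOn.continuousAt hev))
  refine hc.congr ?_
  filter_upwards [hev] with w hw using (hF w hw J hJ).symm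

theorem IsSingularity.eventually [Nontrivial A] [StarModule ℝ A] [IsScalarTower ℝ A A]
    [SMulCommClass ℝ A A] {J : A} (hJ : J ∈ imagUnits A) {Ω : Set A} {z : ℂ}
    (h : IsSingularity Ω (toSlice J z)) : ∀ᶠ w in 𝓝[≠] z, toSlice J w ∈ Ω := by
  obtain ⟨-, R, hR, hsub⟩ := h
  have h1 : ∀ᶠ w in 𝓝[≠] z, toSlice J w ∈ Metric.ball (toSlice J z) R :=
    nhdsWithin_le_nhds
      ((Metric.isOpen_ball.preimage (continuous_toSlice J)).mem_nhds (Metric.mem_ball_self hR))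
  filter_upwards [h1, self_mem_nhdsWithin] with w hw hne
  have hsame : SamePlane (toSlice J w) (toSlice J z) := ⟨J, hJ, ⟨w, rfl⟩, ⟨z, rfl⟩⟩
  refine hsub ⟨toSlice_mem_cone hJ w, ?_, ?_⟩
  · rw [tauDist, if_pos hsame, norm_pos_iff, sub_ne_zero]
    intro e
    apply hne
    have h2 : toSlice J (w - z) = 0 := by
      have : toSlice J (w - z) = toSlice J w - toSlice J z := by
        simp only [toSlice, Complex.sub_re, Complex.sub_im]; module
      rw [this, e, sub_self]
    have h3 := norm_toSlice hJ (w - z)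
    rw [h2, zero_mul, eq_comm, smul_eq_zero, or_iff_left one_ne_zero] at h3
    have h4 : (w - z).re = 0 := by nlinarith [sq_nonneg (w - z).re, sq_nonneg (w - z).im]
    have h5 : (w - z).im = 0 := by nlinarith [sq_nonneg (w - z).re, sq_nonneg (w - z).im]
    exact sub_eq_zero.1 (Complex.ext h4 h5)
  · rw [sigmaDist, if_pos hsame, ← dist_eq_norm]
    exact hw

end Aux

section Quotient

variable [IsScalarTower ℝ A A] [SMulCommClass ℝ A A] [StarModule ℝ A]
  [FiniteDimensional ℝ A] [Nontrivial A]

instance semiregularSetoid (Ω : Set A) : Setoid (SemiregularRep Ω) where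
  r f g := EqOn f.toFun g.toFun (f.dom ∩ g.dom)
  iseqv :=
    { refl := fun _ _ _ => rfl
      symm := fun h x hx => (h hx.symm).symm
      trans := by
        intro f g h hfg hgh x hx
        obtain ⟨E, hE⟩ := f.circular
        have hx' := hx.1
        rw [hE] at hx'
        obtain ⟨hxQ, z, -, J, hJ, rfl⟩ := hx'
        have hg : ∀ᶠ w in 𝓝[≠] z, toSlice J w ∈ g.dom := by
          by_cases hxg : toSlice J z ∈ g.dom
          · exact nhdsWithin_le_nhds (eventually_mem hJ g.regular.1 hxg)
          · rcases g.sing _ ⟨f.dom_subset hx.1, hxg⟩ with hp | hp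
            · exact hp.1.eventually hJ
            · exact hp.1.eventually hJ
        have hf : ∀ᶠ w in 𝓝[≠] z, toSlice J w ∈ f.dom :=
          nhdsWithin_le_nhds (eventually_mem hJ f.regular.1 hx.1)
        have hh : ∀ᶠ w in 𝓝[≠] z, toSlice J w ∈ h.dom :=
          nhdsWithin_le_nhds (eventually_mem hJ h.regular.1 hx.2)
        have c1 := (continuousAt_slice hJ f.regular hx.1).tendsto.mono_left
          (nhdsWithin_le_nhds (s := {z}ᶜ))
        have c2 := (continuousAt_slice hJ h.regular hx.2).tendsto.mono_left
          (nhdsWithin_le_nhds (s := {z}ᶜ))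
        refine tendsto_nhds_unique_of_eventuallyEq c1 c2 ?_
        filter_upwards [hf, hg, hh] with w h1 h2 h3
        exact (hfg ⟨h1, h2⟩).trans (hgh ⟨h2, h3⟩) }

/-- The set of semiregular functions on `Ω`. -/
def Semiregular (Ω : Set A) : Type _ := Quotient (semiregularSetoid Ω)

/-- The semiregular function on `Ω` defined by a representative. -/
def SemiregularRep.toSemiregular {Ω : Set A} (f : SemiregularRep Ω) : Semiregular Ω :=
  Quotient.mk (semiregularSetoid Ω) f

end Quotient

end Slice

end SliceAlg

/-!
A slice function is determined by its stem function, which can be read off on a single slice `ℂ_J`;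
linear functionals on `A` turn the stem function into a family of complex-valued functions. For
slice regular functions these are holomorphic, and a Laurent expansion in the slice powers
`(x - y)^{•n}` restricts on `ℂ_J` to an ordinary Laurent expansion. Hence semiregular functions on
`Ω` correspond to stem functions that are meromorphic on the shadow `{z | α + βJ ∈ Ω}` of `Ω`, and
two of them are identified exactly when their stem functions agree off a discrete set. The
semiregular functions thus embed in the germs of `A_ℂ`-valued functions along the codiscrete filter
of the shadow, where sums, products, conjugates and the identities between them are pointwise; `A_ℂ`
is an alternative *-algebra because `A` is.

On the real line a stem function takes values in `A`, so if `A` is nonsingular, `F F^c = 0` forces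
`F = 0` there, and then on every component that meets the real line, by the identity principle. If a
component `C` misses the real line, it is disjoint from its conjugate, and the stem function with
value `1 + ıJ` on `C`, `1 - ıJ` on the conjugate of `C` and `0` elsewhere has norm zero.
-/

section Alternative

variable {A : Type*} [NonAssocRing A]

theorem IsAlternative.associator_add_swap_left (hA : IsAlternative A) (x y z : A) :
    associator x y z + associator y x z = 0 := by
  have h := (hA (x + y) z).1
  simp only [← AddMonoidHom.associator_apply, map_add, AddMonoidHom.add_apply] at h
  simpa only [AddMonoidHom.associator_apply, (hA _ _).1, zero_add, add_zero, add_comm] using h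

theorem IsAlternative.associator_add_swap_right (hA : IsAlternative A) (x y z : A) :
    associator x y z + associator x z y = 0 := by
  have h := (hA (y + z) x).2
  simp only [← AddMonoidHom.associator_apply, map_add, AddMonoidHom.add_apply] at h
  simpa only [AddMonoidHom.associator_apply, (hA _ _).2, zero_add, add_zero, add_comm] using h

theorem IsAlternative.of_injective {B F : Type*} [NonAssocRing B] [FunLike F A B]
    [NonUnitalRingHomClass F A B] {φ : F} (hφ : Function.Injective φ) (hB : IsAlternative B) :
    IsAlternative A := by
  have map_associator : ∀ x y z, φ (associator x y z) = associator (φ x) (φ y) (φ z) :=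
    fun x y z => by simp only [associator, map_sub, map_mul]
  exact fun x y => ⟨hφ (by rw [map_associator, (hB _ _).1, map_zero]),
    hφ (by rw [map_associator, (hB _ _).2, map_zero])⟩

end Alternative

namespace SliceAlg

/-! ## The complexified algebra as a real *-algebra -/

namespace Cplx

variable {R A : Type*}

instance [SMul R A] : SMul R (Cplx A) := ⟨fun r w => ⟨r • w.re, r • w.im⟩⟩

@[simp] theorem re_smul [SMul R A] (r : R) (w : Cplx A) : (r • w).re = r • w.re := rfl
@[simp] theorem im_smul [SMul R A] (r : R) (w : Cplx A) : (r • w).im = r • w.im := rfl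
@[simp] theorem re_star [Star A] (w : Cplx A) : (star w).re = star w.re := rfl
@[simp] theorem im_star [Star A] (w : Cplx A) : (star w).im = star w.im := rfl

variable [NonAssocRing A]

instance : Add (Cplx A) := ⟨fun v w => ⟨v.re + w.re, v.im + w.im⟩⟩

instance : Neg (Cplx A) := ⟨fun w => ⟨-w.re, -w.im⟩⟩

instance : Sub (Cplx A) := ⟨fun v w => ⟨v.re - w.re, v.im - w.im⟩⟩

@[simp] theorem re_zero : (0 : Cplx A).re = 0 := rfl
@[simp] theorem im_zero : (0 : Cplx A).im = 0 := rfl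
@[simp] theorem re_one : (1 : Cplx A).re = 1 := rfl
@[simp] theorem im_one : (1 : Cplx A).im = 0 := rfl
@[simp] theorem re_add (v w : Cplx A) : (v + w).re = v.re + w.re := rfl
@[simp] theorem im_add (v w : Cplx A) : (v + w).im = v.im + w.im := rfl
@[simp] theorem re_neg (w : Cplx A) : (-w).re = -w.re := rfl
@[simp] theorem im_neg (w : Cplx A) : (-w).im = -w.im := rfl
@[simp] theorem re_sub (v w : Cplx A) : (v - w).re = v.re - w.re := rfl
@[simp] theorem im_sub (v w : Cplx A) : (v - w).im = v.im - w.im := rfl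
@[simp] theorem re_mul (v w : Cplx A) : (v * w).re = v.re * w.re - v.im * w.im := rfl
@[simp] theorem im_mul (v w : Cplx A) : (v * w).im = v.re * w.im + v.im * w.re := rfl
@[simp] theorem re_conj (w : Cplx A) : w.conj.re = w.re := rfl
@[simp] theorem im_conj (w : Cplx A) : w.conj.im = -w.im := rfl
@[simp] theorem re_ofAlg (a : A) : (ofAlg a).re = a := rfl
@[simp] theorem im_ofAlg (a : A) : (ofAlg a).im = 0 := rfl

instance : NonAssocRing (Cplx A) where
  add_assoc u v w := by ext <;> simp [add_assoc]
  zero_add w := by ext <;> simp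
  add_zero w := by ext <;> simp
  add_comm v w := by ext <;> simp [add_comm]
  neg_add_cancel w := by ext <;> simp
  sub_eq_add_neg v w := by ext <;> simp [sub_eq_add_neg]
  nsmul n w := n • w
  nsmul_zero w := by ext <;> simp
  nsmul_succ n w := by ext <;> simp [add_mul]
  zsmul n w := n • w
  zsmul_zero' w := by ext <;> simp
  zsmul_succ' n w := by ext <;> simp [add_mul]
  zsmul_neg' n w := by ext <;> simp [Int.negSucc_eq, add_mul, add_comm]
  left_distrib u v w := by ext <;> simp only [re_mul, im_mul, re_add, im_add, mul_add] <;> abel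
  right_distrib u v w := by ext <;> simp only [re_mul, im_mul, re_add, im_add, add_mul] <;> abel
  zero_mul w := by ext <;> simp
  mul_zero w := by ext <;> simp
  one_mul w := by ext <;> simp
  mul_one w := by ext <;> simp

instance [Nontrivial A] : Nontrivial (Cplx A) :=
  ⟨⟨0, 1, fun h => zero_ne_one (congrArg Cplx.re h)⟩⟩

instance [Semiring R] [Module R A] : Module R (Cplx A) where
  one_smul w := by ext <;> simp
  mul_smul r s w := by ext <;> simp [mul_smul]
  smul_zero r := by ext <;> simp
  smul_add r v w := by ext <;> simp
  add_smul r s w := by ext <;> simp [add_smul]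
  zero_smul w := by ext <;> simp

instance [Monoid R] [DistribMulAction R A] [IsScalarTower R A A] :
    IsScalarTower R (Cplx A) (Cplx A) where
  smul_assoc r v w := by ext <;> simp [smul_mul_assoc, smul_sub]

instance [Monoid R] [DistribMulAction R A] [SMulCommClass R A A] :
    SMulCommClass R (Cplx A) (Cplx A) where
  smul_comm r v w := by ext <;> simp [mul_smul_comm, smul_sub]

instance [StarRing A] : StarRing (Cplx A) where
  star_involutive w := by ext <;> simp
  star_add v w := by ext <;> simp
  star_mul v w := by ext <;> simp [add_comm]

instance [Star R] [SMul R A] [Star A] [StarModule R A] : StarModule R (Cplx A) where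
  star_smul r w := by ext <;> simp

theorem conj_add (v w : Cplx A) : (v + w).conj = v.conj + w.conj := by
  ext <;> simp [add_comm]

theorem conj_mul (v w : Cplx A) : (v * w).conj = v.conj * w.conj := by
  ext <;> simp [add_comm]

theorem conj_smul [Monoid R] [DistribMulAction R A] (r : R) (w : Cplx A) :
    (r • w).conj = r • w.conj := by
  ext <;> simp

theorem conj_star [StarRing A] (w : Cplx A) : (star w).conj = star w.conj := by
  ext <;> simp

theorem conj_conj (w : Cplx A) : w.conj.conj = w := by
  ext <;> simp

theorem conj_ofAlg (a : A) : (ofAlg a).conj = ofAlg a := by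
  ext <;> simp

theorem re_associator (u v w : Cplx A) :
    (associator u v w).re = associator u.re v.re w.re - associator u.re v.im w.im -
      (associator u.im v.re w.im + associator u.im v.im w.re) := by
  simp only [associator, re_sub, re_mul, im_mul, mul_add, add_mul, mul_sub, sub_mul]
  abel

theorem im_associator (u v w : Cplx A) :
    (associator u v w).im = associator u.re v.re w.im + associator u.re v.im w.re +
      associator u.im v.re w.re - associator u.im v.im w.im := by
  simp only [associator, im_sub, re_mul, im_mul, mul_add, add_mul, mul_sub, sub_mul]
  abel

theorem isAlternative (hA : IsAlternative A) : IsAlternative (Cplx A) := by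
  have left := hA.associator_add_swap_left
  have right := hA.associator_add_swap_right
  refine fun v w => ⟨Cplx.ext ?_ ?_, Cplx.ext ?_ ?_⟩
  · rw [re_associator, (hA _ _).1, (hA _ _).1, zero_sub, add_zero, ← neg_add', left, neg_zero,
      re_zero]
  · simp [im_associator, (hA _ _).1, left]
  · simp [re_associator, (hA _ _).2, right]
  · simp [im_associator, (hA _ _).2, right]

end Cplx
/-! ## Evaluation of Laurent terms on a slice -/

section ToSlice

variable {A : Type*} [NormedNonAssocRing A] [NormedSpace ℝ A]

theorem toSlice_neg (J : A) (z : ℂ) : toSlice (-J) z = toSlice J (star z) := by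
  simp [toSlice]

theorem toSlice_add (J : A) (z w : ℂ) : toSlice J (z + w) = toSlice J z + toSlice J w := by
  simp only [toSlice, Complex.add_re, Complex.add_im]; module

theorem toSlice_sub (J : A) (z w : ℂ) : toSlice J (z - w) = toSlice J z - toSlice J w := by
  simp only [toSlice, Complex.sub_re, Complex.sub_im]; module

theorem toSlice_zero (J : A) : toSlice J 0 = 0 := by
  simp [toSlice]

theorem toSlice_one (J : A) : toSlice J 1 = 1 := by
  simp [toSlice]

theorem toSlice_I (J : A) : toSlice J Complex.I = J := by
  simp [toSlice]

theorem toSlice_ofReal (J : A) (r : ℝ) : toSlice J (r : ℂ) = r • (1 : A) := by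
  simp [toSlice]

end ToSlice

section EvalAt

variable {A : Type*} [NormedNonAssocRing A]

theorem evalAt_neg (J : A) (w : Cplx A) : evalAt (-J) w = evalAt J w.conj := by
  simp [evalAt]

theorem evalAt_ofAlg (J a : A) : evalAt J (Cplx.ofAlg a) = a := by
  simp [evalAt]

theorem evalAt_add (J : A) (v w : Cplx A) : evalAt J (v + w) = evalAt J v + evalAt J w := by
  simp only [evalAt, Cplx.re_add, Cplx.im_add, mul_add, add_add_add_comm]

theorem evalAt_smul [NormedSpace ℝ A] [SMulCommClass ℝ A A] (J : A) (r : ℝ) (w : Cplx A) :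
    evalAt J (r • w) = r • evalAt J w := by
  simp only [evalAt, Cplx.re_smul, Cplx.im_smul, mul_smul_comm, smul_add]

end EvalAt

section ImagUnits

variable {A : Type*} [NormedNonAssocRing A] [StarRing A]

theorem neg_mem_imagUnits {J : A} (hJ : J ∈ imagUnits A) : -J ∈ imagUnits A := by
  refine ⟨?_, ?_⟩
  · rw [star_neg, ← neg_add, hJ.1, neg_zero]
  · rw [star_neg, neg_mul_neg, hJ.2]

variable [NormedSpace ℝ A]

theorem imagUnit_mul_self {J : A} (hJ : J ∈ imagUnits A) : J * J = -1 := by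
  rw [← hJ.2, star_imagUnit hJ, mul_neg, neg_neg]

theorem imagUnit_mul_mul (hA : IsAlternative A) {J : A} (hJ : J ∈ imagUnits A) (x : A) :
    J * (J * x) = -x := by
  rw [← sub_eq_zero.1 (hA J x).1, imagUnit_mul_self hJ, neg_mul, one_mul]

variable [IsScalarTower ℝ A A] [SMulCommClass ℝ A A]

theorem toSlice_mul_mul (hA : IsAlternative A) {J : A} (hJ : J ∈ imagUnits A) (z w : ℂ) (x : A) :
    toSlice J z * (toSlice J w * x) = toSlice J (z * w) * x := by
  simp only [toSlice, add_mul, mul_add, smul_mul_assoc, mul_smul_comm, one_mul,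
    imagUnit_mul_mul hA hJ, Complex.mul_re, Complex.mul_im]
  module

end ImagUnits

section Bislice

variable {A : Type*} [NormedNonAssocRing A] [NormedSpace ℝ A]

/-- The element of `ℂ_J + ı ℂ_J ≅ ℂ × ℂ` whose images under `evalAt J` and `evalAt (-J)` are
`toSlice J u` and `toSlice J v`. Products, inverses and powers of such elements are computed
componentwise. -/
noncomputable def bislice (J : A) (u v : ℂ) : Cplx A :=
  ⟨toSlice J ((u + v) / 2), toSlice J (-(Complex.I / 2) * (u - v))⟩

theorem bislice_one (J : A) : bislice J 1 1 = 1 := by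
  ext <;> simp [bislice, toSlice_one, toSlice_zero]

theorem conj_bislice (J : A) (u v : ℂ) : (bislice J u v).conj = bislice J v u := by
  ext
  · simp only [bislice, Cplx.re_conj, add_comm]
  · rw [bislice, Cplx.im_conj, ← zero_sub, ← toSlice_zero J, ← toSlice_sub]
    congr 1
    ring

theorem binomial_eq_bislice (J : A) (z z₀ : ℂ) :
    (⟨z.re • (1 : A) - toSlice J z₀, z.im • (1 : A)⟩ : Cplx A) =
      bislice J (z - z₀) (star z - z₀) := by
  have re_eq : (z - z₀ + (star z - z₀)) / 2 = (z.re : ℂ) - z₀ := by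
    apply Complex.ext <;> simp; ring
  have im_eq : -(Complex.I / 2) * (z - z₀ - (star z - z₀)) = (z.im : ℂ) := by
    apply Complex.ext <;> simp; ring
  ext
  · simp only [bislice, re_eq, toSlice_sub, toSlice_ofReal]
  · simp only [bislice, im_eq, toSlice_ofReal]

variable [StarRing A] [IsScalarTower ℝ A A] [SMulCommClass ℝ A A] {J : A}

theorem bislice_mul_mul (hA : IsAlternative A) (hJ : J ∈ imagUnits A) (u v u' v' : ℂ)
    (w : Cplx A) :
    bislice J u v * (bislice J u' v' * w) = bislice J (u * u') (v * v') * w := by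
  have re_eq : (u * u' + v * v') / 2 = (u + v) / 2 * ((u' + v') / 2) -
      -(Complex.I / 2) * (u - v) * (-(Complex.I / 2) * (u' - v')) := by
    linear_combination ((u - v) * (u' - v') / 4) * Complex.I_sq
  have im_eq : -(Complex.I / 2) * (u * u' - v * v') =
      (u + v) / 2 * (-(Complex.I / 2) * (u' - v')) +
        -(Complex.I / 2) * (u - v) * ((u' + v') / 2) := by ring
  ext <;>
    simp only [bislice, Cplx.re_mul, Cplx.im_mul, mul_add, mul_sub, toSlice_mul_mul hA hJ, re_eq,
      im_eq, toSlice_add, toSlice_sub, add_mul, sub_mul] <;>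
    abel

theorem bislice_mul (hA : IsAlternative A) (hJ : J ∈ imagUnits A) (u v u' v' : ℂ) :
    bislice J u v * bislice J u' v' = bislice J (u * u') (v * v') := by
  simpa using bislice_mul_mul hA hJ u v u' v' 1

theorem bislice_inv (hA : IsAlternative A) (hJ : J ∈ imagUnits A) {u v : ℂ} (hu : u ≠ 0)
    (hv : v ≠ 0) : Cplx.inv (bislice J u v) = bislice J u⁻¹ v⁻¹ := by
  have exists_inverse : ∃ w, bislice J u v * w = 1 ∧ w * bislice J u v = 1 :=
    ⟨bislice J u⁻¹ v⁻¹, by simp [bislice_mul hA hJ, hu, hv, bislice_one],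
      by simp [bislice_mul hA hJ, hu, hv, bislice_one]⟩
  rw [Cplx.inv, dif_pos exists_inverse]
  have cancel := bislice_mul_mul hA hJ u⁻¹ v⁻¹ u v exists_inverse.choose
  rwa [exists_inverse.choose_spec.1, mul_one, inv_mul_cancel₀ hu, inv_mul_cancel₀ hv, bislice_one,
    one_mul, eq_comm] at cancel

theorem bislice_npow (hA : IsAlternative A) (hJ : J ∈ imagUnits A) (u v : ℂ) (n : ℕ) :
    (bislice J u v).npow n = bislice J (u ^ n) (v ^ n) := by
  induction n with
  | zero => simp [Cplx.npow, bislice_one]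
  | succ n ih => rw [Cplx.npow, ih, bislice_mul hA hJ, pow_succ, pow_succ]

theorem bislice_zpow (hA : IsAlternative A) (hJ : J ∈ imagUnits A) {u v : ℂ} (hu : u ≠ 0)
    (hv : v ≠ 0) (n : ℤ) : (bislice J u v).zpow n = bislice J (u ^ n) (v ^ n) := by
  cases n with
  | ofNat n => simp [Cplx.zpow, bislice_npow hA hJ]
  | negSucc n => simp [Cplx.zpow, bislice_inv hA hJ hu hv, bislice_npow hA hJ]

theorem evalAt_bislice_mul (hA : IsAlternative A) (hJ : J ∈ imagUnits A) (u v : ℂ)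
    (w : Cplx A) : evalAt J (bislice J u v * w) = toSlice J u * evalAt J w := by
  have J_mul (x : A) : J * x = toSlice J Complex.I * x := by rw [toSlice_I]
  have eval_re : u = (u + v) / 2 + Complex.I * (-(Complex.I / 2) * (u - v)) := by
    linear_combination ((u - v) / 2) * Complex.I_sq
  have eval_im : u * Complex.I = Complex.I * ((u + v) / 2) - -(Complex.I / 2) * (u - v) := by
    ring
  have re_mul (x : A) : toSlice J u * x = toSlice J ((u + v) / 2) * x +
      toSlice J (Complex.I * (-(Complex.I / 2) * (u - v))) * x := by
    rw [← add_mul, ← toSlice_add, ← eval_re]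
  simp only [evalAt, bislice, Cplx.re_mul, Cplx.im_mul, J_mul, mul_add, toSlice_mul_mul hA hJ]
  rw [eval_im, toSlice_sub, sub_mul, re_mul w.re]
  abel

theorem evalAt_laurentTerm (hA : IsAlternative A) (hJ : J ∈ imagUnits A) {z z₀ : ℂ}
    (hz : z ≠ z₀) (hz' : star z ≠ z₀) (a : A) (n : ℤ) :
    evalAt J (laurentTerm (toSlice J z₀) a n z) = toSlice J ((z - z₀) ^ n) * a := by
  rw [laurentTerm, binomial_eq_bislice, bislice_zpow hA hJ (sub_ne_zero.2 hz) (sub_ne_zero.2 hz'),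
    evalAt_bislice_mul hA hJ, evalAt_ofAlg]

end Bislice
/-! ## Holomorphic and meromorphic functions with values in the complexification -/

theorem contDiffOn_of_forall_dual {𝕜 X E : Type*} [NontriviallyNormedField 𝕜] [CompleteSpace 𝕜]
    [NormedAddCommGroup X] [NormedSpace 𝕜 X] [NormedAddCommGroup E] [NormedSpace 𝕜 E]
    [FiniteDimensional 𝕜 E] {f : X → E} {s : Set X} {n : WithTop ℕ∞}
    (h : ∀ φ : E →ₗ[𝕜] 𝕜, ContDiffOn 𝕜 n (fun x => φ (f x)) s) : ContDiffOn 𝕜 n f s := by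
  let b := Module.finBasis 𝕜 E
  rw [← b.equivFunL.comp_contDiffOn_iff, contDiffOn_pi]
  exact fun i => h (b.coord i)

theorem map_mul_eq_sum {R A ι : Type*} [CommSemiring R] [NonUnitalNonAssocSemiring A] [Module R A]
    [IsScalarTower R A A] [SMulCommClass R A A] [Fintype ι] (b : Module.Basis ι R A)
    (φ : A →ₗ[R] R) (x y : A) :
    φ (x * y) = ∑ i, ∑ j, φ (b i * b j) * (b.coord i x * b.coord j y) := by
  conv_lhs => rw [← b.sum_repr x, ← b.sum_repr y]
  simp only [Finset.sum_mul_sum, map_sum, smul_mul_assoc, mul_smul_comm, map_smul, smul_eq_mul,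
    Module.Basis.coord_apply, mul_left_comm, mul_comm, mul_assoc]

/-- The involution as a real linear map. -/
def starLinearMap (A : Type*) [AddCommMonoid A] [Module ℝ A] [StarAddMonoid A] [StarModule ℝ A] :
    A →ₗ[ℝ] A where
  toFun := star
  map_add' := star_add
  map_smul' r x := by simp

section Coordinates

variable {A : Type*} [NonAssocRing A] [Module ℝ A]

/-- The complex linear extension to `A_ℂ` of a real linear functional on `A`. It is only recorded
as a real linear map, since `Cplx A` is not given a complex module structure. -/
def Cplx.coord (φ : A →ₗ[ℝ] ℝ) : Cplx A →ₗ[ℝ] ℂ where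
  toFun w := ⟨φ w.re, φ w.im⟩
  map_add' v w := by apply Complex.ext <;> simp
  map_smul' r w := by apply Complex.ext <;> simp

@[simp] theorem Cplx.re_coord (φ : A →ₗ[ℝ] ℝ) (w : Cplx A) : (Cplx.coord φ w).re = φ w.re := rfl

@[simp] theorem Cplx.im_coord (φ : A →ₗ[ℝ] ℝ) (w : Cplx A) : (Cplx.coord φ w).im = φ w.im := rfl

theorem Cplx.eq_zero_of_coord {w : Cplx A} (h : ∀ φ : A →ₗ[ℝ] ℝ, Cplx.coord φ w = 0) :
    w = 0 :=
  Cplx.ext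
    ((Module.forall_dual_apply_eq_zero_iff ℝ w.re).1 fun φ => congrArg Complex.re (h φ))
    ((Module.forall_dual_apply_eq_zero_iff ℝ w.im).1 fun φ => congrArg Complex.im (h φ))

theorem Cplx.coord_mul [IsScalarTower ℝ A A] [SMulCommClass ℝ A A] {ι : Type*} [Fintype ι]
    (b : Module.Basis ι ℝ A) (φ : A →ₗ[ℝ] ℝ) (v w : Cplx A) :
    Cplx.coord φ (v * w) =
      ∑ i, ∑ j, (φ (b i * b j) : ℂ) * (Cplx.coord (b.coord i) v * Cplx.coord (b.coord j) w) := by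
  apply Complex.ext
  · rw [Cplx.re_coord, Cplx.re_mul, map_sub, map_mul_eq_sum b φ v.re, map_mul_eq_sum b φ v.im]
    simp only [Complex.re_sum, Complex.re_ofReal_mul]
    simp only [Complex.mul_re, Cplx.re_coord, Cplx.im_coord, mul_sub, Finset.sum_sub_distrib]
  · rw [Cplx.im_coord, Cplx.im_mul, map_add, map_mul_eq_sum b φ v.re, map_mul_eq_sum b φ v.im]
    simp only [Complex.im_sum, Complex.im_ofReal_mul]
    simp only [Complex.mul_im, Cplx.re_coord, Cplx.im_coord, mul_add, Finset.sum_add_distrib]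

/-- Holomorphy near a point of a function with values in `A_ℂ`, tested on real functionals. -/
def IsHolAt (F : ℂ → Cplx A) (z : ℂ) : Prop :=
  ∀ φ : A →ₗ[ℝ] ℝ, AnalyticAt ℂ (fun w => Cplx.coord φ (F w)) z

/-- Meromorphy at a point of a function with values in `A_ℂ`, tested on real functionals. -/
def IsMeroAt (F : ℂ → Cplx A) (z : ℂ) : Prop :=
  ∀ φ : A →ₗ[ℝ] ℝ, MeromorphicAt (fun w => Cplx.coord φ (F w)) z

variable {F G : ℂ → Cplx A} {z : ℂ}

theorem IsHolAt.isMeroAt (h : IsHolAt F z) : IsMeroAt F z := fun φ => (h φ).meromorphicAt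

theorem isHolAt_const (w : Cplx A) (z : ℂ) : IsHolAt (fun _ => w) z := fun _ => analyticAt_const

theorem IsHolAt.congr (h : IsHolAt F z) (e : F =ᶠ[𝓝 z] G) : IsHolAt G z := fun φ =>
  (h φ).congr (e.fun_comp (Cplx.coord φ))

theorem IsMeroAt.congr (h : IsMeroAt F z) (e : F =ᶠ[𝓝[≠] z] G) : IsMeroAt G z := fun φ =>
  (h φ).congr (e.fun_comp (Cplx.coord φ))

theorem IsHolAt.add (hF : IsHolAt F z) (hG : IsHolAt G z) : IsHolAt (fun w => F w + G w) z :=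
  fun φ => by simpa only [map_add] using (hF φ).fun_add (hG φ)

theorem IsMeroAt.add (hF : IsMeroAt F z) (hG : IsMeroAt G z) : IsMeroAt (fun w => F w + G w) z :=
  fun φ => by simpa only [map_add] using (hF φ).fun_add (hG φ)

theorem IsHolAt.smul (r : ℝ) (hF : IsHolAt F z) : IsHolAt (fun w => r • F w) z :=
  fun φ => by simpa only [map_smul, Complex.real_smul] using analyticAt_const.fun_mul (hF φ)

theorem IsMeroAt.smul (r : ℝ) (hF : IsMeroAt F z) : IsMeroAt (fun w => r • F w) z :=
  fun φ => by
    simpa only [map_smul, Complex.real_smul] using (MeromorphicAt.const (r : ℂ) z).fun_mul (hF φ)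

theorem IsHolAt.star [StarRing A] [StarModule ℝ A] (hF : IsHolAt F z) :
    IsHolAt (fun w => star (F w)) z := fun φ => hF (φ ∘ₗ starLinearMap A)

theorem IsMeroAt.star [StarRing A] [StarModule ℝ A] (hF : IsMeroAt F z) :
    IsMeroAt (fun w => star (F w)) z := fun φ => hF (φ ∘ₗ starLinearMap A)

variable [FiniteDimensional ℝ A]

theorem IsHolAt.mul [IsScalarTower ℝ A A] [SMulCommClass ℝ A A] (hF : IsHolAt F z)
    (hG : IsHolAt G z) : IsHolAt (fun w => F w * G w) z := fun φ => by
  simp only [Cplx.coord_mul (Module.finBasis ℝ A)]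
  exact Finset.analyticAt_fun_sum _ fun i _ => Finset.analyticAt_fun_sum _ fun j _ =>
    analyticAt_const.fun_mul ((hF _).fun_mul (hG _))

theorem IsMeroAt.mul [IsScalarTower ℝ A A] [SMulCommClass ℝ A A] (hF : IsMeroAt F z)
    (hG : IsMeroAt G z) : IsMeroAt (fun w => F w * G w) z := fun φ => by
  simp only [Cplx.coord_mul (Module.finBasis ℝ A)]
  exact MeromorphicAt.fun_sum fun i _ => MeromorphicAt.fun_sum fun j _ =>
    (MeromorphicAt.const _ z).fun_mul ((hF _).fun_mul (hG _))

end Coordinates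

section CauchyRiemann

variable {A : Type*} [NormedNonAssocRing A] [NormedSpace ℝ A] [FiniteDimensional ℝ A]
  {F : ℂ → Cplx A} {D : Set ℂ} {z : ℂ}

theorem differentiableAt_coord_iff (φ : A →ₗ[ℝ] ℝ)
    (hre : DifferentiableAt ℝ (fun w => (F w).re) z)
    (him : DifferentiableAt ℝ (fun w => (F w).im) z) :
    DifferentiableAt ℂ (fun w => Cplx.coord φ (F w)) z ↔ Cplx.coord φ (dbar F z) = 0 := by
  let ψ := LinearMap.toContinuousLinearMap φ
  have hasFDeriv : HasFDerivAt (fun w => Cplx.coord φ (F w))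
      (Complex.equivRealProdCLM.symm.toContinuousLinearMap.comp
        ((ψ.comp (fderiv ℝ (fun w => (F w).re) z)).prod
          (ψ.comp (fderiv ℝ (fun w => (F w).im) z)))) z :=
    Complex.equivRealProdCLM.symm.hasFDerivAt.comp z
      ((ψ.hasFDerivAt.comp z hre.hasFDerivAt).prodMk (ψ.hasFDerivAt.comp z him.hasFDerivAt))
  have fderiv_apply (v : ℂ) : fderiv ℝ (fun w => Cplx.coord φ (F w)) z v =
      ⟨φ (fderiv ℝ (fun w => (F w).re) z v), φ (fderiv ℝ (fun w => (F w).im) z v)⟩ := by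
    rw [hasFDeriv.fderiv]; rfl
  rw [differentiableAt_complex_iff_differentiableAt_real,
    and_iff_right hasFDeriv.differentiableAt]
  simp only [fderiv_apply, Complex.ext_iff, Cplx.re_coord, Cplx.im_coord, smul_eq_mul,
    Complex.mul_re, Complex.mul_im, Complex.I_re, Complex.I_im, dbar, map_smul, map_sub, map_add,
    Complex.zero_re, Complex.zero_im]
  constructor <;> rintro ⟨h, h'⟩ <;> constructor <;> linarith

theorem IsC1.isHolAt (hD : IsOpen D) (h : IsC1 D F) (hF : ∀ z ∈ D, dbar F z = 0) (hz : z ∈ D) :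
    IsHolAt F z := by
  refine fun φ => DifferentiableOn.analyticAt (s := D) (fun w hw => ?_) (hD.mem_nhds hz)
  refine ((differentiableAt_coord_iff φ
    ((h.1.differentiableOn one_ne_zero).differentiableAt (hD.mem_nhds hw))
    ((h.2.differentiableOn one_ne_zero).differentiableAt (hD.mem_nhds hw))).2
      ?_).differentiableWithinAt
  rw [hF w hw, map_zero]

theorem isC1_of_isHolAt (h : ∀ z ∈ D, IsHolAt F z) : IsC1 D F := by
  have coord_contDiffOn (φ : A →ₗ[ℝ] ℝ) : ContDiffOn ℝ 1 (fun z => Cplx.coord φ (F z)) D :=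
    fun z hz => ((h z hz φ).contDiffAt.restrict_scalars ℝ).contDiffWithinAt
  exact ⟨contDiffOn_of_forall_dual fun φ =>
      Complex.reCLM.contDiff.comp_contDiffOn (coord_contDiffOn φ),
    contDiffOn_of_forall_dual fun φ =>
      Complex.imCLM.contDiff.comp_contDiffOn (coord_contDiffOn φ)⟩

theorem dbar_eq_zero_of_isHolAt (hD : IsOpen D) (h : ∀ z ∈ D, IsHolAt F z) (hz : z ∈ D) :
    dbar F z = 0 := by
  have hC1 := isC1_of_isHolAt h
  exact Cplx.eq_zero_of_coord fun φ => (differentiableAt_coord_iff φ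
    ((hC1.1.differentiableOn one_ne_zero).differentiableAt (hD.mem_nhds hz))
    ((hC1.2.differentiableOn one_ne_zero).differentiableAt (hD.mem_nhds hz))).1
    (h z hz φ).differentiableAt

end CauchyRiemann

/-! ## Slices, circular sets and their shadows -/

section Cone

variable {A : Type*} [NormedNonAssocRing A] [NormedSpace ℝ A] [StarRing A]
  [IsScalarTower ℝ A A] [SMulCommClass ℝ A A] [StarModule ℝ A]

theorem imagUnit_of_quadratic {x : A} {t n : ℝ} (ht : x + star x = t • (1 : A))
    (hn : x * star x = n • (1 : A)) (h : t ^ 2 < 4 * n) :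
    (√(n - t ^ 2 / 4))⁻¹ • (x - (t / 2) • (1 : A)) ∈ imagUnits A := by
  set β := √(n - t ^ 2 / 4) with hβ
  have hβ0 : β ≠ 0 := (Real.sqrt_pos.2 (by linarith)).ne'
  have hβ2 : β⁻¹ * β⁻¹ * (n - t ^ 2 / 4) = 1 := by
    rw [← Real.mul_self_sqrt (by linarith : 0 ≤ n - t ^ 2 / 4), ← hβ]
    field_simp
  have star_eq : star x = t • (1 : A) - x := by rw [← ht]; abel
  have sq_eq : x * x = t • x - n • (1 : A) := by
    rw [← hn, star_eq, mul_sub, mul_smul_comm, mul_one]; abel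
  have star_unit : star (β⁻¹ • (x - (t / 2) • (1 : A))) = -(β⁻¹ • (x - (t / 2) • (1 : A))) := by
    simp only [star_smul, star_sub, star_one, star_trivial, star_eq]
    module
  refine ⟨by rw [star_unit, add_neg_cancel], ?_⟩
  refine Eq.trans ?_ (by rw [hβ2, one_smul] : (β⁻¹ * β⁻¹ * (n - t ^ 2 / 4)) • (1 : A) = 1)
  rw [star_unit]
  simp only [mul_neg, smul_mul_assoc, mul_smul_comm, sub_mul, mul_sub, one_mul, mul_one, sq_eq]
  module

theorem exists_toSlice_eq (hS : (imagUnits A).Nonempty) {x : A} (hx : x ∈ quadraticCone A) :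
    ∃ J ∈ imagUnits A, ∃ z : ℂ, x = toSlice J z := by
  rcases hx with ⟨r, rfl⟩ | ⟨t, n, ht, hn, h⟩
  · obtain ⟨J, hJ⟩ := hS
    exact ⟨J, hJ, r, (toSlice_ofReal J r).symm⟩
  · have hβ0 : √(n - t ^ 2 / 4) ≠ 0 := (Real.sqrt_pos.2 (by linarith)).ne'
    refine ⟨_, imagUnit_of_quadratic ht hn h, ⟨t / 2, √(n - t ^ 2 / 4)⟩, ?_⟩
    rw [toSlice, smul_inv_smul₀ hβ0, add_sub_cancel]

theorem toSlice_mem_circularization_of_mem {D : Set ℂ} {J : A} (hJ : J ∈ imagUnits A) {z : ℂ}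
    (hz : z ∈ D) : toSlice J z ∈ (circularization D : Set A) :=
  ⟨toSlice_mem_cone hJ z, z, hz, J, hJ, rfl⟩

end Cone

section Shadow

variable {A : Type*} [NormedNonAssocRing A] [NormedSpace ℝ A] [StarRing A]

/-- The set of all `α + i β` such that some `α + β J` lies in `Ω`. For `Ω = Ω_D` with `D`
invariant under conjugation this is `D`. -/
def shadow (Ω : Set A) : Set ℂ := {z | ∃ J ∈ imagUnits A, toSlice J z ∈ Ω}

theorem conjInvariant_shadow (Ω : Set A) : ConjInvariant (shadow Ω) := by
  rintro z ⟨J, hJ, hz⟩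
  exact ⟨-J, neg_mem_imagUnits hJ, by rwa [toSlice_neg, star_star]⟩

theorem shadow_mono {Ω Ω' : Set A} (h : Ω ⊆ Ω') : shadow Ω ⊆ shadow Ω' :=
  fun _ ⟨J, hJ, hz⟩ => ⟨J, hJ, h hz⟩

theorem IsOpenInCone.isOpen_shadow [IsScalarTower ℝ A A] [SMulCommClass ℝ A A] [StarModule ℝ A]
    {Ω : Set A} (h : IsOpenInCone Ω) : IsOpen (shadow Ω) := by
  rw [isOpen_iff_mem_nhds]
  rintro z ⟨J, hJ, hz⟩
  filter_upwards [eventually_mem hJ h hz] with w hw using ⟨J, hJ, hw⟩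

end Shadow

section Geometry

variable {A : Type*} [NormedNonAssocRing A] [NormedSpace ℝ A] [StarRing A]
  [IsScalarTower ℝ A A] [SMulCommClass ℝ A A] [StarModule ℝ A] [Nontrivial A]

theorem toSlice_eq_cases {J K : A} (hJ : J ∈ imagUnits A) (hK : K ∈ imagUnits A) {z w : ℂ}
    (h : toSlice J z = toSlice K w) :
    (z = w ∧ (z.im = 0 ∨ J = K)) ∨ (z = star w ∧ (z.im = 0 ∨ J = -K)) := by
  have smul_one_injective := smul_left_injective ℝ (one_ne_zero (α := A))
  have re_eq : z.re = w.re := by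
    have := smul_one_injective ((trace_toSlice hJ z).symm.trans (h ▸ trace_toSlice hK w))
    linarith
  have sq_eq : z.re ^ 2 + z.im ^ 2 = w.re ^ 2 + w.im ^ 2 :=
    smul_one_injective ((norm_toSlice hJ z).symm.trans (h ▸ norm_toSlice hK w))
  have smul_eq : z.im • J = w.im • K := by
    simpa [toSlice, re_eq] using h
  rw [re_eq] at sq_eq
  rcases sq_eq_sq_iff_eq_or_eq_neg.1 (add_left_cancel sq_eq) with im_eq | im_eq
  · refine Or.inl ⟨Complex.ext re_eq im_eq, or_iff_not_imp_left.2 fun h0 => ?_⟩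
    rw [← im_eq] at smul_eq
    exact smul_right_injective A h0 smul_eq
  · refine Or.inr ⟨Complex.ext (by simpa using re_eq) (by simpa using im_eq),
      or_iff_not_imp_left.2 fun h0 => ?_⟩
    rw [show w.im = -z.im by rw [im_eq, neg_neg], neg_smul, ← smul_neg] at smul_eq
    exact smul_right_injective A h0 smul_eq

theorem toSlice_mem_circularization {J : A} (hJ : J ∈ imagUnits A) {D : Set ℂ}
    (hD : ConjInvariant D) {z : ℂ} : toSlice J z ∈ (circularization D : Set A) ↔ z ∈ D :=
  ⟨toSlice_mem_iff hJ hD z, toSlice_mem_circularization_of_mem hJ⟩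

theorem shadow_circularization (hS : (imagUnits A).Nonempty) {D : Set ℂ} (hD : ConjInvariant D) :
    shadow (circularization D : Set A) = D := by
  obtain ⟨J, hJ⟩ := hS
  ext z
  exact ⟨fun ⟨_, hK, h⟩ => (toSlice_mem_circularization hK hD).1 h,
    fun h => ⟨J, hJ, toSlice_mem_circularization_of_mem hJ h⟩⟩

theorem IsCircular.circularization_shadow {Ω : Set A} (h : IsCircular Ω) :
    circularization (shadow Ω) = Ω := by
  obtain ⟨E, rfl⟩ := h
  ext x
  constructor
  · rintro ⟨-, z, ⟨K, hK, -, w, hw, L, hL, e⟩, J, hJ, rfl⟩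
    rcases toSlice_eq_cases hK hL e with ⟨rfl, -⟩ | ⟨rfl, -⟩
    · exact toSlice_mem_circularization_of_mem hJ hw
    · rw [← toSlice_neg]
      exact toSlice_mem_circularization_of_mem (neg_mem_imagUnits hJ) hw
  · rintro ⟨-, z, hz, J, hJ, rfl⟩
    exact toSlice_mem_circularization_of_mem hJ ⟨J, hJ, toSlice_mem_circularization_of_mem hJ hz⟩

theorem IsCircular.shadow_nonempty {Ω : Set A} (h : IsCircular Ω) (hne : Ω.Nonempty) :
    (shadow Ω).Nonempty := by
  rw [← h.circularization_shadow] at hne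
  obtain ⟨-, -, z, hz, -⟩ := hne
  exact ⟨z, hz⟩

theorem IsCircular.toSlice_mem {Ω : Set A} (h : IsCircular Ω) {J : A} (hJ : J ∈ imagUnits A)
    {z : ℂ} : toSlice J z ∈ Ω ↔ z ∈ shadow Ω := by
  conv_lhs => rw [← h.circularization_shadow]
  exact toSlice_mem_circularization hJ (conjInvariant_shadow Ω)

theorem IsCircular.circularization_shadow_inter {Ω Ω' : Set A} (h : IsCircular Ω)
    (h' : IsCircular Ω') : circularization (shadow Ω ∩ shadow Ω') = Ω ∩ Ω' := by
  ext x
  constructor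
  · rintro ⟨-, z, ⟨hz, hz'⟩, J, hJ, rfl⟩
    exact ⟨(h.toSlice_mem hJ).2 hz, (h'.toSlice_mem hJ).2 hz'⟩
  · rintro ⟨hx, hx'⟩
    rw [← h.circularization_shadow] at hx
    obtain ⟨-, z, hz, J, hJ, rfl⟩ := hx
    exact toSlice_mem_circularization_of_mem hJ ⟨hz, (h'.toSlice_mem hJ).1 hx'⟩

end Geometry

section Metric

variable {A : Type*} [NormedNonAssocRing A] [NormedSpace ℝ A] [StarRing A] [StarModule ℝ A]

theorem rePart_toSlice {J : A} (hJ : J ∈ imagUnits A) (z : ℂ) :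
    rePart (toSlice J z) = z.re • (1 : A) := by
  rw [rePart, trace_toSlice hJ]
  module

theorem imPart_toSlice {J : A} (hJ : J ∈ imagUnits A) (z : ℂ) :
    imPart (toSlice J z) = z.im • J := by
  simp only [imPart, toSlice, star_add, star_smul, star_one, star_imagUnit hJ, star_trivial]
  module

variable [IsScalarTower ℝ A A] [SMulCommClass ℝ A A] [Nontrivial A] {J K : A} {z z₀ : ℂ} {R : ℝ}

theorem norm_toSlice_eq (hN : NormCompatible A) (hJ : J ∈ imagUnits A) (z : ℂ) :
    ‖toSlice J z‖ = ‖z‖ := by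
  have sq_eq : z.re ^ 2 + z.im ^ 2 = ‖toSlice J z‖ ^ 2 :=
    smul_left_injective ℝ (one_ne_zero (α := A))
      ((norm_toSlice hJ z).symm.trans (hN _ (toSlice_mem_cone hJ z)))
  rw [← sq_eq_sq₀ (norm_nonneg _) (norm_nonneg _), ← sq_eq, Complex.sq_norm, Complex.normSq_apply]
  ring

theorem norm_imPart_toSlice (hN : NormCompatible A) (hJ : J ∈ imagUnits A) (z : ℂ) :
    ‖imPart (toSlice J z)‖ = |z.im| := by
  have norm_eq := norm_toSlice_eq hN hJ (z.im * Complex.I)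
  rw [imPart_toSlice hJ]
  simpa [toSlice] using norm_eq

theorem toSlice_mem_sigmaAnnulus (hN : NormCompatible A) (hJ : J ∈ imagUnits A) :
    toSlice J z ∈ sigmaAnnulus (toSlice J z₀) 0 R ↔ 0 < ‖z - z₀‖ ∧ ‖z - z₀‖ < R := by
  have samePlane : SamePlane (toSlice J z) (toSlice J z₀) := ⟨J, hJ, ⟨z, rfl⟩, ⟨z₀, rfl⟩⟩
  rw [sigmaAnnulus, mem_ofPred_eq, tauDist, sigmaDist, if_pos samePlane, if_pos samePlane,
    ← toSlice_sub, norm_toSlice_eq hN hJ, and_iff_right (toSlice_mem_cone hJ z)]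

theorem SamePlane.exists_toSlice {x : A} (hJ : J ∈ imagUnits A)
    (h : SamePlane x (toSlice J z₀)) :
    ∃ L ∈ imagUnits A, toSlice L z₀ = toSlice J z₀ ∧ ∃ w, x = toSlice L w := by
  obtain ⟨L, hL, ⟨w, rfl⟩, v, hv⟩ := h
  rcases toSlice_eq_cases hL hJ hv with ⟨rfl, -⟩ | ⟨rfl, -⟩
  · exact ⟨L, hL, hv, w, rfl⟩
  · exact ⟨-L, neg_mem_imagUnits hL, by rw [toSlice_neg, hv], star w, by
      rw [toSlice_neg, star_star]⟩

theorem samePlane_of_mem_sigmaAnnulus (hN : NormCompatible A) (hJ : J ∈ imagUnits A)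
    (hK : K ∈ imagUnits A) (hR : z₀.im = 0 ∨ R ≤ |z₀.im|)
    (h : toSlice K z ∈ sigmaAnnulus (toSlice J z₀) 0 R) :
    SamePlane (toSlice K z) (toSlice J z₀) := by
  rcases hR with h0 | hR
  · refine ⟨K, hK, ⟨z, rfl⟩, z₀, ?_⟩
    simp [toSlice, h0]
  · by_contra hp
    have lt_radius := h.2.2
    rw [sigmaDist, if_neg hp, norm_imPart_toSlice hN hJ, norm_imPart_toSlice hN hK] at lt_radius
    have le_dist : |z₀.im| ≤ √(‖rePart (toSlice K z) - rePart (toSlice J z₀)‖ ^ 2 +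
        (|z.im| + |z₀.im|) ^ 2) := by
      apply Real.le_sqrt_of_sq_le
      nlinarith [abs_nonneg z.im, abs_nonneg z₀.im,
        sq_nonneg ‖rePart (toSlice K z) - rePart (toSlice J z₀)‖]
    linarith

theorem exists_continuous_toSlice_eq [FiniteDimensional ℝ A] (hN : NormCompatible A) :
    ∃ p : A → ℂ, Continuous p ∧ ∀ J ∈ imagUnits A, ∀ z, p (toSlice J z) = ⟨z.re, |z.im|⟩ := by
  obtain ⟨φ, hφ⟩ := SeparatingDual.exists_eq_one (R := ℝ) (one_ne_zero (α := A))
  have continuous_star : Continuous (star : A → A) :=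
    (starLinearMap A).continuous_of_finiteDimensional
  refine ⟨fun x => Complex.equivRealProdCLM.symm (φ (rePart x), ‖imPart x‖), ?_, fun J hJ z => ?_⟩
  · unfold rePart imPart
    fun_prop
  · dsimp only
    rw [rePart_toSlice hJ, norm_imPart_toSlice hN hJ, map_smul, hφ, smul_eq_mul, mul_one]
    rfl

theorem isOpenInCone_circularization [FiniteDimensional ℝ A] (hS : (imagUnits A).Nonempty)
    (hN : NormCompatible A) {D : Set ℂ} (hD : IsOpen D) (hc : ConjInvariant D) :
    IsOpenInCone (circularization D : Set A) := by
  obtain ⟨p, continuous_p, hp⟩ := exists_continuous_toSlice_eq hN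
  have mem_iff (J) (hJ : J ∈ imagUnits A) (z : ℂ) : p (toSlice J z) ∈ D ↔ z ∈ D := by
    rw [hp J hJ]
    rcases abs_choice z.im with h | h
    · rw [h]
    · rw [h]
      exact ⟨fun hz => star_star z ▸ hc _ hz, hc z⟩
  refine ⟨_, hD.preimage continuous_p, Set.ext fun x => ⟨?_, fun ⟨hx, hq⟩ => ?_⟩⟩
  · rintro ⟨hx, z, hz, J, hJ, rfl⟩
    exact ⟨(mem_iff J hJ z).2 hz, hx⟩
  · obtain ⟨J, hJ, z, rfl⟩ := exists_toSlice_eq hS hq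
    exact toSlice_mem_circularization_of_mem hJ ((mem_iff J hJ z).1 hx)

end Metric

/-! ## Stem functions and the slice functions they induce -/

section Stem

variable {A : Type*} [NormedNonAssocRing A] [NormedSpace ℝ A]

/-- The stem function recovered from the values of a slice function on `ℂ_J`. -/
noncomputable def stemOf (J : A) (f : A → A) (z : ℂ) : Cplx A :=
  ⟨(1 / 2 : ℝ) • (f (toSlice J z) + f (toSlice J (star z))),
    -(1 / 2 : ℝ) • (J * (f (toSlice J z) - f (toSlice J (star z))))⟩

variable {D : Set ℂ} {F : ℂ → Cplx A}

theorem IsStem.im_eq_zero (h : IsStem D F) {z : ℂ} (hz : z ∈ D) (h0 : z.im = 0) :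
    (F z).im = 0 := by
  have star_eq : star z = z := Complex.ext (by simp) (by simp [h0])
  have neg_eq : (F z).im = -(F z).im := by
    simpa only [star_eq, Cplx.im_conj] using congrArg Cplx.im (h.2.2 z hz)
  have : IsAddTorsionFree A := .of_isTorsionFree ℝ A
  exact self_eq_neg.1 neg_eq

variable [StarRing A]

theorem Induces.eq_stemOf (hA : IsAlternative A) {Ω : Set A} {f : A → A} (h : Induces Ω D F f)
    {J : A} (hJ : J ∈ imagUnits A) {z : ℂ} (hz : z ∈ D) : stemOf J f z = F z := by
  obtain ⟨-, ⟨-, hD, hstem⟩, heval⟩ := h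
  rw [stemOf, heval z hz J hJ, heval _ (hD z hz) J hJ, hstem z hz]
  ext
  · simp only [evalAt, Cplx.re_conj, Cplx.im_conj, mul_neg]
    module
  · simp only [evalAt, Cplx.re_conj, Cplx.im_conj, mul_neg, mul_sub, mul_add,
      imagUnit_mul_mul hA hJ]
    module

variable [IsScalarTower ℝ A A] [SMulCommClass ℝ A A] [StarModule ℝ A] [Nontrivial A]

theorem IsStem.evalAt_congr (h : IsStem D F) {J K : A} (hJ : J ∈ imagUnits A)
    (hK : K ∈ imagUnits A) {z w : ℂ} (hw : w ∈ D) (e : toSlice J z = toSlice K w) :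
    evalAt J (F z) = evalAt K (F w) := by
  rcases toSlice_eq_cases hJ hK e with ⟨rfl, h0 | rfl⟩ | ⟨rfl, h0 | rfl⟩
  · simp [evalAt, h.im_eq_zero hw h0]
  · rfl
  · have hw0 : w.im = 0 := by simpa using h0
    rw [h.2.2 w hw]
    simp [evalAt, h.im_eq_zero hw hw0]
  · rw [h.2.2 w hw, evalAt_neg, Cplx.conj_conj]

theorem IsStem.exists_induces (h : IsStem D F) :
    ∃ f : A → A, Induces (circularization D) D F f := by
  have exists_value (x : A) :
      ∃ y, ∀ z ∈ D, ∀ J ∈ imagUnits A, x = toSlice J z → y = evalAt J (F z) := by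
    by_cases hx : ∃ w ∈ D, ∃ K ∈ imagUnits A, x = toSlice K w
    · obtain ⟨w, -, K, hK, rfl⟩ := hx
      exact ⟨evalAt K (F w), fun z hz J hJ e => h.evalAt_congr hK hJ hz e⟩
    · exact ⟨0, fun z hz J hJ e => (hx ⟨z, hz, J, hJ, e⟩).elim⟩
  choose f hf using exists_value
  exact ⟨f, rfl, h, fun z hz J hJ => hf _ z hz J hJ rfl⟩

end Stem
/-! ## Laurent expansions and poles -/

theorem hasSum_int_iff_of_eq_zero_of_lt {M : Type*} [AddCommMonoid M] [TopologicalSpace M]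
    {c : ℤ → M} {s : M} {N : ℤ} (hc : ∀ n < N, c n = 0) :
    HasSum c s ↔ HasSum (fun k : ℕ => c (k + N)) s := by
  have injective_shift : Function.Injective fun k : ℕ => (k : ℤ) + N := fun a b hab => by
    simpa using hab
  refine (injective_shift.hasSum_iff fun n hn => hc n ?_).symm
  by_contra! le
  exact hn ⟨(n - N).toNat, by simp [Int.toNat_of_nonneg (sub_nonneg.2 le)]⟩

section LaurentSeries

variable {𝕜 E : Type*} [NontriviallyNormedField 𝕜] [NormedAddCommGroup E] [NormedSpace 𝕜 E]
  {g : 𝕜 → E} {z₀ : 𝕜}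

theorem meromorphicAt_of_hasSum_pow {a : ℕ → E}
    (h : ∀ᶠ z in 𝓝[≠] z₀, HasSum (fun n : ℕ => (z - z₀) ^ n • a n) (g z)) :
    MeromorphicAt g z₀ := by
  classical
  have analyticAt_update : AnalyticAt 𝕜 (Function.update g z₀ (a 0)) z₀ := by
    let p : FormalMultilinearSeries 𝕜 𝕜 E := fun n =>
      ContinuousMultilinearMap.mkPiRing 𝕜 (Fin n) (a n)
    have coeff_p (n : ℕ) : p.coeff n = a n := by
      simp [p, FormalMultilinearSeries.coeff]
    refine ⟨p, hasFPowerSeriesAt_iff'.2 ?_⟩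
    filter_upwards [eventually_nhdsWithin_iff.1 h] with z hz
    simp only [coeff_p]
    rcases eq_or_ne z z₀ with rfl | hne
    · rw [Function.update_self, sub_self]
      exact HasSum.hasSum_at_zero a
    · rw [Function.update_of_ne hne]
      exact hz hne
  refine analyticAt_update.meromorphicAt.congr ?_
  filter_upwards [self_mem_nhdsWithin] with z hne using Function.update_of_ne hne ..

theorem meromorphicAt_of_hasSum_zpow {c : ℤ → E} {N : ℤ} (hc : ∀ n < N, c n = 0)
    (h : ∀ᶠ z in 𝓝[≠] z₀, HasSum (fun n : ℤ => (z - z₀) ^ n • c n) (g z)) :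
    MeromorphicAt g z₀ := by
  have meromorphicAt_shift : MeromorphicAt (fun z => (z - z₀) ^ (-N) • g z) z₀ := by
    refine meromorphicAt_of_hasSum_pow (a := fun k => c (k + N)) ?_
    filter_upwards [h, self_mem_nhdsWithin] with z hz hne
    rw [hasSum_int_iff_of_eq_zero_of_lt (N := N) fun n hn => by rw [hc n hn, smul_zero]] at hz
    refine (hz.const_smul ((z - z₀) ^ (-N))).congr_fun fun k => ?_
    rw [smul_smul, ← zpow_add₀ (sub_ne_zero.2 hne), neg_add_cancel_comm_assoc, zpow_natCast]
  refine ((((MeromorphicAt.id z₀).sub (MeromorphicAt.const z₀ z₀)).zpow N).smul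
    meromorphicAt_shift).congr ?_
  filter_upwards [self_mem_nhdsWithin] with z hne
  simp [smul_smul, mul_inv_cancel₀ (zpow_ne_zero N (sub_ne_zero.2 hne))]

theorem exists_hasSum_zpow_of_meromorphicAt (h : MeromorphicAt g z₀) :
    ∃ (c : ℤ → E) (N : ℤ), (∀ n < N, c n = 0) ∧
      ∀ᶠ z in 𝓝[≠] z₀, HasSum (fun n : ℤ => (z - z₀) ^ n • c n) (g z) := by
  obtain ⟨N, G, ⟨p, hp⟩, hg⟩ := MeromorphicAt.iff_eventuallyEq_zpow_smul_analyticAt.1 h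
  rw [hasFPowerSeriesAt_iff'] at hp
  have zero_of_lt (n : ℤ) (hn : n < N) : (if n < N then 0 else p.coeff (n - N).toNat) = 0 :=
    if_pos hn
  refine ⟨_, N, zero_of_lt, ?_⟩
  filter_upwards [nhdsWithin_le_nhds hp, hg, self_mem_nhdsWithin] with z hz hgz hne
  rw [hgz, hasSum_int_iff_of_eq_zero_of_lt (N := N) fun n hn => by rw [zero_of_lt n hn, smul_zero]]
  refine (hz.const_smul ((z - z₀) ^ N)).congr_fun fun k => ?_
  simp [add_comm (k : ℤ), zpow_add₀ (sub_ne_zero.2 hne), smul_smul]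

end LaurentSeries

theorem tendsto_star_nhdsNE {X : Type*} [TopologicalSpace X] [InvolutiveStar X] [ContinuousStar X]
    {x : X} (hx : star x = x) : Tendsto star (𝓝[≠] x) (𝓝[≠] x) := by
  refine tendsto_nhdsWithin_iff.2 ⟨?_, ?_⟩
  · simpa only [hx] using (continuous_star.tendsto x).mono_left nhdsWithin_le_nhds
  · filter_upwards [self_mem_nhdsWithin] with z hne h
    exact hne (star_injective ((h : star z = x).trans hx.symm))

theorem eventually_star_ne_nhdsNE {X : Type*} [TopologicalSpace X] [T1Space X] [InvolutiveStar X]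
    [ContinuousStar X] (x : X) : ∀ᶠ z in 𝓝[≠] x, star z ≠ x := by
  by_cases hx : star x = x
  · exact (tendsto_star_nhdsNE hx).eventually self_mem_nhdsWithin
  · exact nhdsWithin_le_nhds (continuous_star.continuousAt.eventually_ne hx)

theorem exists_real_hasSum_zpow_of_meromorphicAt {g : ℂ → ℂ} {z₀ : ℂ} (h : MeromorphicAt g z₀)
    (h0 : z₀.im = 0) (hs : ∀ᶠ z in 𝓝[≠] z₀, g (star z) = star (g z)) :
    ∃ (c : ℤ → ℂ) (N : ℤ), (∀ n, (c n).im = 0) ∧ (∀ n < N, c n = 0) ∧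
      ∀ᶠ z in 𝓝[≠] z₀, HasSum (fun n : ℤ => (z - z₀) ^ n • c n) (g z) := by
  obtain ⟨c, N, hc, hsum⟩ := exists_hasSum_zpow_of_meromorphicAt h
  have star_z₀ : star z₀ = z₀ := Complex.ext (by simp) (by simp [h0])
  refine ⟨fun n => ((c n).re : ℂ), N, fun n => Complex.ofReal_im _,
    fun n hn => by simp [hc n hn], ?_⟩
  filter_upwards [hsum, (tendsto_star_nhdsNE star_z₀).eventually hsum, hs] with z hz hz_star hs
  have average_value : (1 / 2 : ℂ) * (g z + star (g (star z))) = g z := by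
    rw [hs, star_star]; ring
  rw [← average_value]
  refine ((hz.add hz_star.star).mul_left (1 / 2)).congr_fun fun n => ?_
  have star_term : star ((star z - z₀) ^ n • c n) = (z - z₀) ^ n • star (c n) := by
    rw [smul_eq_mul, star_mul', star_zpow₀, star_sub, star_star, star_z₀, smul_eq_mul]
  have add_star : c n + star (c n) = 2 * ((c n).re : ℂ) := by
    simpa using Complex.add_conj (c n)
  rw [star_term, ← smul_add, add_star]
  simp only [smul_eq_mul]
  ring
section SliceFunctional

variable {A : Type*} [NormedNonAssocRing A] [NormedSpace ℝ A] [SMulCommClass ℝ A A]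

/-- The functional `a ↦ φ(a) - i φ(J a)`, complex linear for the complex structure given by left
multiplication by `J`. -/
def sliceFunctional (J : A) (φ : A →ₗ[ℝ] ℝ) : A →ₗ[ℝ] ℂ where
  toFun a := ⟨φ a, -φ (J * a)⟩
  map_add' a b := by apply Complex.ext <;> simp [mul_add, add_comm]
  map_smul' r a := by apply Complex.ext <;> simp [mul_smul_comm]

theorem re_sliceFunctional (J : A) (φ : A →ₗ[ℝ] ℝ) (a : A) :
    (sliceFunctional J φ a).re = φ a := rfl

theorem im_sliceFunctional (J : A) (φ : A →ₗ[ℝ] ℝ) (a : A) :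
    (sliceFunctional J φ a).im = -φ (J * a) := rfl

variable [StarRing A] {J : A}

theorem coord_eq_sliceFunctional (hA : IsAlternative A) (hJ : J ∈ imagUnits A)
    (φ : A →ₗ[ℝ] ℝ) (w : Cplx A) :
    Cplx.coord φ w = (1 / 2 : ℂ) * (sliceFunctional J φ (evalAt J w) +
      sliceFunctional (-J) φ (evalAt (-J) w)) := by
  rw [show (1 / 2 : ℂ) = ((1 / 2 : ℝ) : ℂ) by norm_num]
  apply Complex.ext <;>
    simp only [Complex.re_ofReal_mul, Complex.im_ofReal_mul, Complex.add_re, Complex.add_im,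
      re_sliceFunctional, im_sliceFunctional, Cplx.re_coord, Cplx.im_coord] <;>
    simp only [evalAt, mul_add, neg_mul, mul_neg, imagUnit_mul_mul hA hJ, map_add, map_neg] <;>
    ring

variable [IsScalarTower ℝ A A]

theorem sliceFunctional_toSlice_mul (hA : IsAlternative A) (hJ : J ∈ imagUnits A)
    (φ : A →ₗ[ℝ] ℝ) (z : ℂ) (a : A) :
    sliceFunctional J φ (toSlice J z * a) = z * sliceFunctional J φ a := by
  apply Complex.ext <;>
    simp only [re_sliceFunctional, im_sliceFunctional, Complex.mul_re, Complex.mul_im] <;>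
    simp only [toSlice, add_mul, smul_mul_assoc, one_mul, mul_add, mul_smul_comm,
      imagUnit_mul_mul hA hJ, map_add, map_smul, map_neg, smul_eq_mul] <;>
    ring

end SliceFunctional

section MeromorphicOfSingularity

variable {A : Type*} [NormedNonAssocRing A] [NormedSpace ℝ A] [StarRing A]
  [IsScalarTower ℝ A A] [SMulCommClass ℝ A A] [StarModule ℝ A] [Nontrivial A]
  [FiniteDimensional ℝ A] {J : A} {Ω : Set A} {D : Set ℂ} {F : ℂ → Cplx A} {f : A → A} {z₀ : ℂ}

theorem IsPole.meromorphicAt_sliceFunctional (hA : IsAlternative A) (hN : NormCompatible A)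
    (hJ : J ∈ imagUnits A) (h : IsPole Ω f (toSlice J z₀)) (φ : A →ₗ[ℝ] ℝ) :
    MeromorphicAt (fun z => sliceFunctional J φ (f (toSlice J z))) z₀ := by
  obtain ⟨-, a, ⟨R, hR, -, hsum⟩, m, ha⟩ := h
  have coeff_zero (n : ℤ) (hn : n < -m) : sliceFunctional J φ (a n) = 0 := by
    rw [show n = -((-n).toNat : ℤ) by omega, ha _ (by omega), map_zero]
  refine meromorphicAt_of_hasSum_zpow coeff_zero ?_
  filter_upwards [nhdsWithin_le_nhds (Metric.ball_mem_nhds z₀ hR), self_mem_nhdsWithin,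
    eventually_star_ne_nhdsNE z₀] with z hz hne hne_star
  have mem_annulus : toSlice J z ∈ sigmaAnnulus (toSlice J z₀) 0 R :=
    (toSlice_mem_sigmaAnnulus hN hJ).2
      ⟨norm_pos_iff.2 (sub_ne_zero.2 hne), mem_ball_iff_norm.1 hz⟩
  refine ((sliceFunctional J φ).toContinuousLinearMap.hasSum (hsum z J hJ mem_annulus)).congr_fun
    fun n => ?_
  rw [evalAt_laurentTerm hA hJ hne hne_star, LinearMap.coe_toContinuousLinearMap',
    sliceFunctional_toSlice_mul hA hJ, smul_eq_mul]

theorem IsRemovable.isMeroAt (hA : IsAlternative A) (hJ : J ∈ imagUnits A)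
    (hf : Induces Ω D F f) (hD : ∀ᶠ z in 𝓝[≠] z₀, z ∈ D)
    (h : IsRemovable Ω f (toSlice J z₀)) : IsMeroAt F z₀ := by
  obtain ⟨-, V, g, -, -, hy, ⟨isOpen_V, D', G, hg, hG, hdbar⟩, hfg⟩ := h
  have hD' : ConjInvariant D' := hg.2.1.2.1
  have isOpen_D' : IsOpen D' := by
    rw [← shadow_circularization ⟨J, hJ⟩ hD', ← hg.1]
    exact isOpen_V.isOpen_shadow
  have hz₀ : z₀ ∈ D' := toSlice_mem_iff hJ hD' _ (hg.1 ▸ hy)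
  refine (hG.isHolAt isOpen_D' hdbar hz₀).isMeroAt.congr ?_
  filter_upwards [hD, nhdsWithin_le_nhds (isOpen_D'.mem_nhds hz₀)] with z hz hz'
  have value_eq (w : ℂ) (hw : w ∈ D) : g (toSlice J w) = f (toSlice J w) :=
    hfg (hf.1 ▸ toSlice_mem_circularization_of_mem hJ hw)
  rw [← hf.eq_stemOf hA hJ hz, ← hg.eq_stemOf hA hJ hz', stemOf, stemOf, value_eq z hz,
    value_eq _ (hf.2.1.2.1 z hz)]

theorem Induces.isMeroAt (hA : IsAlternative A) (hN : NormCompatible A)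
    (hJ : J ∈ imagUnits A) (hf : Induces Ω D F f) (hD : ∀ᶠ z in 𝓝[≠] z₀, z ∈ D)
    (h : ∀ K ∈ imagUnits A, IsPole Ω f (toSlice K z₀) ∨ IsRemovable Ω f (toSlice K z₀)) :
    IsMeroAt F z₀ := by
  have hJ' := neg_mem_imagUnits hJ
  rcases h J hJ with pole | removable
  · rcases h (-J) hJ' with pole' | removable
    · intro φ
      refine ((MeromorphicAt.const (1 / 2 : ℂ) z₀).mul
        ((pole.meromorphicAt_sliceFunctional hA hN hJ φ).add
          (pole'.meromorphicAt_sliceFunctional hA hN hJ' φ))).congr ?_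
      filter_upwards [hD] with z hz
      rw [coord_eq_sliceFunctional hA hJ, ← hf.2.2 z hz J hJ, ← hf.2.2 z hz _ hJ']
      rfl
    · exact removable.isMeroAt hA hJ' hf hD
  · exact removable.isMeroAt hA hJ hf hD

end MeromorphicOfSingularity

section LaurentOfMeromorphic

variable {A : Type*} [NormedNonAssocRing A] [NormedSpace ℝ A]
  {D : Set ℂ} {F : ℂ → Cplx A} {z₀ : ℂ}

theorem exists_hasSum_coord_of_isMeroAt (hF : IsStem D F) (hD : ∀ᶠ z in 𝓝[≠] z₀, z ∈ D)
    (h : IsMeroAt F z₀) (φ : A →ₗ[ℝ] ℝ) :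
    ∃ (c : ℤ → ℂ) (N : ℤ), (z₀.im = 0 → ∀ n, (c n).im = 0) ∧ (∀ n < N, c n = 0) ∧
      ∀ᶠ z in 𝓝[≠] z₀, HasSum (fun n : ℤ => (z - z₀) ^ n • c n) (Cplx.coord φ (F z)) := by
  by_cases h0 : z₀.im = 0
  · have symm : ∀ᶠ z in 𝓝[≠] z₀, Cplx.coord φ (F (star z)) = star (Cplx.coord φ (F z)) := by
      filter_upwards [hD] with z hz
      rw [hF.2.2 z hz]
      apply Complex.ext <;> simp
    obtain ⟨c, N, hreal, hc⟩ := exists_real_hasSum_zpow_of_meromorphicAt (h φ) h0 symm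
    exact ⟨c, N, fun _ => hreal, hc⟩
  · obtain ⟨c, N, hc⟩ := exists_hasSum_zpow_of_meromorphicAt (h φ)
    exact ⟨c, N, fun h => absurd h h0, hc⟩

variable [IsScalarTower ℝ A A]

theorem evalAt_eq_sum [SMulCommClass ℝ A A] {ι : Type*} [Fintype ι] (b : Module.Basis ι ℝ A)
    (J : A) (w : Cplx A) :
    evalAt J w = ∑ i, toSlice J (Cplx.coord (b.coord i) w) * b i := by
  conv_lhs => rw [evalAt, ← b.sum_repr w.re, ← b.sum_repr w.im, Finset.mul_sum]
  simp only [toSlice, Cplx.re_coord, Cplx.im_coord, add_mul, smul_mul_assoc, one_mul,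
    mul_smul_comm, Finset.sum_add_distrib, Module.Basis.coord_apply]

/-- The real linear map `z ↦ (α + β J) a`, where `z = α + i β`. -/
def toSliceMul (J a : A) : ℂ →ₗ[ℝ] A where
  toFun z := toSlice J z * a
  map_add' z w := by rw [toSlice_add, add_mul]
  map_smul' r z := by
    simp only [toSlice, Complex.smul_re, Complex.smul_im, smul_eq_mul, mul_smul, ← smul_add,
      smul_mul_assoc, RingHom.id_apply]

variable [StarRing A] [SMulCommClass ℝ A A] {J : A}

theorem hasSum_evalAt (hA : IsAlternative A) {ι κ : Type*} [Fintype ι] (b : Module.Basis ι ℝ A)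
    (hJ : J ∈ imagUnits A) {w : Cplx A} {ζ : κ → ℂ} {c : ι → κ → ℂ}
    (h : ∀ i, HasSum (fun n => ζ n • c i n) (Cplx.coord (b.coord i) w)) :
    HasSum (fun n => toSlice J (ζ n) * ∑ i, toSlice J (c i n) * b i) (evalAt J w) := by
  rw [evalAt_eq_sum b]
  refine (hasSum_sum fun i _ =>
    (toSliceMul J (b i)).toContinuousLinearMap.hasSum (h i)).congr_fun fun n => ?_
  rw [Finset.mul_sum]
  exact Finset.sum_congr rfl fun i _ => toSlice_mul_mul hA hJ _ _ _

theorem isStem_laurentTerm (hA : IsAlternative A) (hJ : J ∈ imagUnits A) (a : A) (n : ℤ) :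
    IsStem {z | z ≠ z₀ ∧ star z ≠ z₀} (laurentTerm (toSlice J z₀) a n) := by
  refine ⟨⟨((z₀.re + 1 : ℝ) : ℂ), ?_, ?_⟩, fun z hz => ⟨hz.2, by rw [star_star]; exact hz.1⟩,
    fun z ⟨hz, hz'⟩ => ?_⟩
  · exact fun e => by simpa using congrArg Complex.re e
  · exact fun e => by simpa using congrArg Complex.re e
  · have hu := sub_ne_zero.2 hz
    have hv := sub_ne_zero.2 hz'
    rw [laurentTerm, laurentTerm, binomial_eq_bislice, binomial_eq_bislice, star_star,
      bislice_zpow hA hJ hv hu, bislice_zpow hA hJ hu hv, Cplx.conj_mul, conj_bislice,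
      Cplx.conj_ofAlg]

variable [StarModule ℝ A] [Nontrivial A]

theorem exists_toSlice_eq_of_mem_sigmaAnnulus (hN : NormCompatible A) (hJ : J ∈ imagUnits A)
    {R : ℝ} (hR : z₀.im = 0 ∨ R ≤ |z₀.im|) {x : A} (hx : x ∈ sigmaAnnulus (toSlice J z₀) 0 R) :
    ∃ L ∈ imagUnits A, toSlice L z₀ = toSlice J z₀ ∧
      ∃ w, x = toSlice L w ∧ 0 < ‖w - z₀‖ ∧ ‖w - z₀‖ < R := by
  obtain ⟨K, hK, z, rfl⟩ := exists_toSlice_eq ⟨J, hJ⟩ hx.1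
  obtain ⟨L, hL, e, w, hw⟩ :=
    (samePlane_of_mem_sigmaAnnulus hN hJ hK hR hx).exists_toSlice hJ
  rw [hw, ← e] at hx
  exact ⟨L, hL, e, w, hw, (toSlice_mem_sigmaAnnulus hN hL).1 hx⟩

variable [FiniteDimensional ℝ A]

theorem IsMeroAt.exists_hasSum_evalAt (hA : IsAlternative A) (hJ : J ∈ imagUnits A)
    (hF : IsStem D F) (hD : ∀ᶠ z in 𝓝[≠] z₀, z ∈ D) (h : IsMeroAt F z₀) :
    ∃ (a : ℤ → A) (N : ℤ), (∀ n < N, a n = 0) ∧ ∀ᶠ z in 𝓝[≠] z₀, ∀ L ∈ imagUnits A,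
      toSlice L z₀ = toSlice J z₀ →
        HasSum (fun n : ℤ => toSlice L ((z - z₀) ^ n) * a n) (evalAt L (F z)) := by
  let b := Module.finBasis ℝ A
  choose c N hreal hzero hsum using fun i => exists_hasSum_coord_of_isMeroAt hF hD h (b.coord i)
  obtain ⟨M, hM⟩ := (Set.finite_range N).bddBelow
  refine ⟨fun n => ∑ i, toSlice J (c i n) * b i, M,
    fun n hn => Finset.sum_eq_zero fun i _ => ?_, ?_⟩
  · rw [hzero i n (hn.trans_le (hM ⟨i, rfl⟩)), toSlice_zero, zero_mul]
  · filter_upwards [eventually_all.2 hsum] with z hz L hL e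
    have coeff_eq (i) (n : ℤ) : toSlice J (c i n) = toSlice L (c i n) := by
      rcases toSlice_eq_cases hL hJ e with ⟨-, h0 | rfl⟩ | ⟨h_star, -⟩
      · simp [toSlice, hreal i h0 n]
      · rfl
      · have h0 : z₀.im = 0 := by
          have := congrArg Complex.im h_star
          simp only [Complex.star_def, Complex.conj_im] at this
          linarith
        simp [toSlice, hreal i h0 n]
    simp only [coeff_eq]
    exact hasSum_evalAt hA b hL hz

theorem exists_radius_of_eventually_nhdsNE {p : ℂ → Prop} (h : ∀ᶠ z in 𝓝[≠] z₀, p z) :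
    ∃ R > 0, (z₀.im = 0 ∨ R ≤ |z₀.im|) ∧ ∀ z, 0 < ‖z - z₀‖ → ‖z - z₀‖ < R → p z := by
  obtain ⟨R, hR, hp⟩ := Metric.eventually_nhds_iff.1 (eventually_nhdsWithin_iff.1 h)
  have hp' (z : ℂ) (h0 : 0 < ‖z - z₀‖) (hlt : ‖z - z₀‖ < R) : p z :=
    hp (dist_eq_norm z z₀ ▸ hlt) (sub_ne_zero.1 (norm_pos_iff.1 h0))
  by_cases h0 : z₀.im = 0
  · exact ⟨R, hR, Or.inl h0, hp'⟩
  · exact ⟨min R |z₀.im|, lt_min hR (abs_pos.2 h0), Or.inr (min_le_right _ _),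
      fun z hz hlt => hp' z hz (hlt.trans_le (min_le_left _ _))⟩

theorem IsMeroAt.isPole (hA : IsAlternative A) (hN : NormCompatible A) (hJ : J ∈ imagUnits A)
    {Ω : Set A} {f : A → A} (hf : Induces Ω D F f) (hD : ∀ᶠ z in 𝓝[≠] z₀, z ∈ D)
    (h : IsMeroAt F z₀) : IsPole Ω f (toSlice J z₀) := by
  obtain ⟨rfl, hF, hval⟩ := hf
  obtain ⟨a, N, hzero, hsum⟩ := h.exists_hasSum_evalAt hA hJ hF hD
  obtain ⟨R, hR, hR_im, hR_good⟩ :=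
    exists_radius_of_eventually_nhdsNE (hD.and (hsum.and (eventually_star_ne_nhdsNE z₀)))
  have annulus_subset : sigmaAnnulus (toSlice J z₀) 0 R ⊆ circularization D := by
    intro x hx
    obtain ⟨L, hL, -, w, rfl, hw⟩ := exists_toSlice_eq_of_mem_sigmaAnnulus hN hJ hR_im hx
    exact toSlice_mem_circularization_of_mem hL (hR_good w hw.1 hw.2).1
  refine ⟨⟨toSlice_mem_cone hJ z₀, R, hR, annulus_subset⟩, a,
    ⟨R, hR, annulus_subset, fun z K hK hz => ?_⟩, (-N).toNat, fun k hk => hzero _ (by omega)⟩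
  obtain ⟨L, hL, center_eq, w, hw, w_pos, w_lt⟩ :=
    exists_toSlice_eq_of_mem_sigmaAnnulus hN hJ hR_im hz
  obtain ⟨hwD, hasSum_w, hne_star⟩ := hR_good w w_pos w_lt
  have hne : w ≠ z₀ := sub_ne_zero.1 (norm_pos_iff.1 w_pos)
  rw [hw, hval w hwD L hL]
  refine (hasSum_w L hL center_eq).congr_fun fun n => ?_
  rw [(isStem_laurentTerm hA hJ (a n) n).evalAt_congr hK hL ⟨hne, hne_star⟩ hw, ← center_eq,
    evalAt_laurentTerm hA hL hne hne_star]

end LaurentOfMeromorphic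
/-! ## Real *-algebras embedded in germs -/

section Transport

/-- The star ring structure pulled back along an injective ring homomorphism commuting with the
star operations. -/
abbrev starRingOfInjective {S B : Type*} [NonUnitalNonAssocSemiring S]
    [NonUnitalNonAssocSemiring B] [Star S] [StarRing B] (φ : S →ₙ+* B)
    (hφ : Function.Injective φ) (map_star : ∀ s, φ (star s) = star (φ s)) : StarRing S where
  star_involutive s := hφ (by rw [map_star, map_star, star_star])
  star_mul s t := hφ (by rw [map_star, map_mul, map_mul, map_star, map_star, star_mul])
  star_add s t := hφ (by rw [map_star, map_add, map_add, map_star, map_star, star_add])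

theorem exists_starAlgebra_of_injective {R S B : Type*} [Ring R] [NonAssocRing B] [Module R B]
    [StarRing B] (ι : S → B) (hι : Function.Injective ι) (one_mem : ∃ s, ι s = 1)
    (add_mem : ∀ s t, ∃ u, ι u = ι s + ι t) (mul_mem : ∀ s t, ∃ u, ι u = ι s * ι t)
    (star_mem : ∀ s, ∃ u, ι u = star (ι s)) (smul_mem : ∀ (r : R) s, ∃ u, ι u = r • ι s) :
    ∃ (_ : NonAssocRing S) (_ : Module R S) (_ : StarRing S) (φ : S →⋆ₙₐ[R] B),
      ⇑φ = ι ∧ φ 1 = 1 := by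
  obtain ⟨one, map_one⟩ := one_mem
  choose add map_add using add_mem
  choose mul map_mul using mul_mem
  choose st map_star using star_mem
  choose sm map_smul using smul_mem
  let : One S := ⟨one⟩
  let : Zero S := ⟨sm 0 one⟩
  let : Add S := ⟨add⟩
  let : Mul S := ⟨mul⟩
  let : Star S := ⟨st⟩
  let : SMul R S := ⟨sm⟩
  let : Neg S := ⟨sm (-1)⟩
  let : Sub S := ⟨fun s t => s + -t⟩
  let : SMul ℕ S := ⟨fun n => sm n⟩
  let : SMul ℤ S := ⟨fun n => sm n⟩
  let : NatCast S := ⟨fun n => sm n one⟩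
  let : IntCast S := ⟨fun n => sm n one⟩
  have map_zero : ι 0 = 0 := (map_smul 0 one).trans (zero_smul R _)
  have map_neg (s : S) : ι (-s) = -ι s :=
    (map_smul (-1) s).trans (by rw [neg_smul, one_smul])
  let : NonAssocRing S := hι.nonAssocRing ι map_zero map_one map_add map_mul map_neg
    (fun s t => (map_add s (-t)).trans (by rw [map_neg, sub_eq_add_neg]))
    (fun n s => (map_smul n s).trans (Nat.cast_smul_eq_nsmul R n _))
    (fun n s => (map_smul n s).trans (Int.cast_smul_eq_zsmul R n _))
    (fun n => (map_smul n one).trans (by rw [map_one, Nat.cast_smul_eq_nsmul, nsmul_one]))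
    (fun n => (map_smul n one).trans (by rw [map_one, Int.cast_smul_eq_zsmul, zsmul_one]))
  let φ : S →ₙ+* B :=
    { toFun := ι, map_zero' := map_zero, map_add' := map_add, map_mul' := map_mul }
  let : Module R S := hι.module R φ.toAddMonoidHom map_smul
  exact ⟨_, _, starRingOfInjective φ hι map_star,
    { φ with map_smul' := map_smul, map_star' := map_star }, rfl, map_one⟩

theorem isScalarTower_of_injective {R S B : Type*} [Monoid R] [NonAssocRing S]
    [DistribMulAction R S] [NonAssocRing B] [DistribMulAction R B] [IsScalarTower R B B]
    {φ : S →ₙₐ[R] B} (hφ : Function.Injective φ) : IsScalarTower R S S :=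
  ⟨fun r x y => hφ (by simp only [smul_eq_mul, map_mul, map_smul, smul_mul_assoc])⟩

theorem smulCommClass_of_injective {R S B : Type*} [Monoid R] [NonAssocRing S]
    [DistribMulAction R S] [NonAssocRing B] [DistribMulAction R B] [SMulCommClass R B B]
    {φ : S →ₙₐ[R] B} (hφ : Function.Injective φ) : SMulCommClass R S S :=
  ⟨fun r x y => hφ (by simp only [smul_eq_mul, map_mul, map_smul, mul_smul_comm])⟩

theorem starModule_of_injective {R S B : Type*} [Monoid R] [Star R] [NonAssocRing S]
    [DistribMulAction R S] [Star S] [NonAssocRing B] [DistribMulAction R B] [Star B]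
    [StarModule R B] {φ : S →⋆ₙₐ[R] B} (hφ : Function.Injective φ) : StarModule R S :=
  ⟨fun r x => hφ (by simp only [map_star, map_smul, star_smul])⟩

theorem isNonsingular_iff_of_injective {F S B : Type*} [NonAssocRing S] [Star S]
    [NonAssocRing B] [Star B] [FunLike F S B] [NonUnitalRingHomClass F S B] [StarHomClass F S B]
    {φ : F} (hφ : Function.Injective φ) :
    IsNonsingular S ↔ ∀ s, φ s * star (φ s) = 0 → φ s = 0 := by
  simp only [IsNonsingular, ← map_star, ← map_mul, map_eq_zero_iff φ hφ]

end Transport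

section GermAlgebra

variable {α B : Type*} {l : Filter α} [NonAssocRing B]

instance germStarRing [StarRing B] : StarRing (Germ l B) where
  star := Germ.map star
  star_involutive x := x.inductionOn fun f => congrArg Germ.ofFun (star_star f)
  star_mul x y := x.inductionOn₂ y fun f g => congrArg Germ.ofFun (star_mul f g)
  star_add x y := x.inductionOn₂ y fun f g => congrArg Germ.ofFun (star_add f g)

theorem germ_isAlternative (hB : IsAlternative B) : IsAlternative (Germ l B) := fun x y =>
  x.inductionOn₂ y fun f g =>
    ⟨congrArg Germ.ofFun (funext fun a => (hB (f a) (g a)).1 : associator f f g = 0),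
      congrArg Germ.ofFun (funext fun a => (hB (f a) (g a)).2 : associator g f f = 0)⟩

variable {R : Type*} [Semiring R] [Module R B]

instance germIsScalarTower [IsScalarTower R B B] : IsScalarTower R (Germ l B) (Germ l B) where
  smul_assoc r x y := x.inductionOn₂ y fun f g => congrArg Germ.ofFun (smul_mul_assoc r f g)

instance germSMulCommClass [SMulCommClass R B B] : SMulCommClass R (Germ l B) (Germ l B) where
  smul_comm r x y := x.inductionOn₂ y fun f g =>
    congrArg Germ.ofFun (mul_smul_comm r f g).symm

instance germStarModule [Star R] [StarRing B] [StarModule R B] :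
    StarModule R (Germ l B) where
  star_smul r x := x.inductionOn fun f => congrArg Germ.ofFun (star_smul r f)

end GermAlgebra

/-! ## Meromorphic stem functions -/

section Codiscrete

variable {X : Type*} [TopologicalSpace X] {U : Set X}

theorem eventually_codiscreteWithin_iff (hU : IsOpen U) {p : X → Prop} :
    (∀ᶠ w in codiscreteWithin U, p w) ↔ ∀ z ∈ U, ∀ᶠ w in 𝓝[≠] z, p w := by
  refine mem_codiscreteWithin_iff_forall_mem_nhdsNE.trans (forall₂_congr fun z hz => ?_)
  refine ⟨fun h => ?_, fun h => mem_of_superset h subset_union_left⟩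
  filter_upwards [h, nhdsWithin_le_nhds (hU.mem_nhds hz)] with w hw hwU
  exact hw.resolve_right (not_not_intro hwU)

theorem neBot_codiscreteWithin [∀ x : X, (𝓝[≠] x).NeBot] (hU : IsOpen U) (hne : U.Nonempty) :
    (codiscreteWithin U).NeBot := by
  obtain ⟨z, hz⟩ := hne
  exact NeBot.mono inferInstance fun _ h => (eventually_codiscreteWithin_iff hU).1 h z hz

end Codiscrete

section MeroStem

variable {A : Type*} [NormedNonAssocRing A] [NormedSpace ℝ A]

/-- `F` is a stem function, holomorphic on the open set `D` and meromorphic on `U`, the complement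
of `D` in `U` being discrete. These are the stem functions of the semiregular functions on `Ω`,
where `U` is the shadow of `Ω`. -/
structure IsMeroStem (U D : Set ℂ) (F : ℂ → Cplx A) : Prop where
  isOpen : IsOpen D
  subset : D ⊆ U
  mem_codiscreteWithin : D ∈ codiscreteWithin U
  isStem : IsStem D F
  isHolAt : ∀ z ∈ D, IsHolAt F z
  isMeroAt : ∀ z ∈ U, IsMeroAt F z

theorem IsHolAt.eq_of_eventually_nhdsNE [FiniteDimensional ℝ A] {F G : ℂ → Cplx A} {z : ℂ}
    (hF : IsHolAt F z) (hG : IsHolAt G z) (h : ∀ᶠ w in 𝓝[≠] z, F w = G w) : F z = G z := by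
  refine sub_eq_zero.1 (Cplx.eq_zero_of_coord fun φ => ?_)
  rw [map_sub, sub_eq_zero]
  exact (((hF φ).continuousAt.eventuallyEq_nhds_iff_eventuallyEq_nhdsNE
    (hG φ).continuousAt).1 (h.mono fun w hw => congrArg _ hw)).eq_of_nhds

variable {U D D' : Set ℂ} {F G : ℂ → Cplx A}

theorem isMeroStem_of_isHolAt (hU : IsOpen U) (hF : IsStem U F) (h : ∀ z ∈ U, IsHolAt F z) :
    IsMeroStem U U F where
  isOpen := hU
  subset := subset_rfl
  mem_codiscreteWithin := self_mem_codiscreteWithin U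
  isStem := hF
  isHolAt := h
  isMeroAt z hz := (h z hz).isMeroAt

theorem isMeroStem_ofAlg (hU : IsOpen U) (hne : U.Nonempty) (hconj : ConjInvariant U) (a : A) :
    IsMeroStem U U (fun _ => Cplx.ofAlg a) :=
  isMeroStem_of_isHolAt hU ⟨hne, hconj, fun _ _ => (Cplx.conj_ofAlg a).symm⟩
    fun _ _ => isHolAt_const _ _

namespace IsMeroStem

theorem inter_nonempty (hU : IsOpen U) (hF : IsMeroStem U D F) (hG : IsMeroStem U D' G) :
    (D ∩ D').Nonempty :=
  have := neBot_codiscreteWithin hU (hF.isStem.1.mono hF.subset)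
  nonempty_of_mem (inter_mem hF.mem_codiscreteWithin hG.mem_codiscreteWithin)

theorem add (hU : IsOpen U) (hF : IsMeroStem U D F) (hG : IsMeroStem U D' G) :
    IsMeroStem U (D ∩ D') (fun z => F z + G z) where
  isOpen := hF.isOpen.inter hG.isOpen
  subset := inter_subset_left.trans hF.subset
  mem_codiscreteWithin := inter_mem hF.mem_codiscreteWithin hG.mem_codiscreteWithin
  isStem := ⟨inter_nonempty hU hF hG,
    fun z hz => ⟨hF.isStem.2.1 z hz.1, hG.isStem.2.1 z hz.2⟩,
    fun z hz => by
      dsimp only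
      rw [hF.isStem.2.2 z hz.1, hG.isStem.2.2 z hz.2, Cplx.conj_add]⟩
  isHolAt z hz := (hF.isHolAt z hz.1).add (hG.isHolAt z hz.2)
  isMeroAt z hz := (hF.isMeroAt z hz).add (hG.isMeroAt z hz)

theorem mul [IsScalarTower ℝ A A] [SMulCommClass ℝ A A] [FiniteDimensional ℝ A]
    (hU : IsOpen U) (hF : IsMeroStem U D F) (hG : IsMeroStem U D' G) :
    IsMeroStem U (D ∩ D') (fun z => F z * G z) where
  isOpen := hF.isOpen.inter hG.isOpen
  subset := inter_subset_left.trans hF.subset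
  mem_codiscreteWithin := inter_mem hF.mem_codiscreteWithin hG.mem_codiscreteWithin
  isStem := ⟨inter_nonempty hU hF hG,
    fun z hz => ⟨hF.isStem.2.1 z hz.1, hG.isStem.2.1 z hz.2⟩,
    fun z hz => by
      dsimp only
      rw [hF.isStem.2.2 z hz.1, hG.isStem.2.2 z hz.2, Cplx.conj_mul]⟩
  isHolAt z hz := (hF.isHolAt z hz.1).mul (hG.isHolAt z hz.2)
  isMeroAt z hz := (hF.isMeroAt z hz).mul (hG.isMeroAt z hz)

protected theorem star [StarRing A] [StarModule ℝ A] (hF : IsMeroStem U D F) :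
    IsMeroStem U D (fun z => star (F z)) where
  isOpen := hF.isOpen
  subset := hF.subset
  mem_codiscreteWithin := hF.mem_codiscreteWithin
  isStem := ⟨hF.isStem.1, hF.isStem.2.1, fun z hz => by
    dsimp only
    rw [hF.isStem.2.2 z hz, Cplx.conj_star]⟩
  isHolAt z hz := (hF.isHolAt z hz).star
  isMeroAt z hz := (hF.isMeroAt z hz).star

theorem smul (r : ℝ) (hF : IsMeroStem U D F) : IsMeroStem U D (fun z => r • F z) where
  isOpen := hF.isOpen
  subset := hF.subset
  mem_codiscreteWithin := hF.mem_codiscreteWithin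
  isStem := ⟨hF.isStem.1, hF.isStem.2.1, fun z hz => by
    dsimp only
    rw [hF.isStem.2.2 z hz, Cplx.conj_smul]⟩
  isHolAt z hz := (hF.isHolAt z hz).smul r
  isMeroAt z hz := (hF.isMeroAt z hz).smul r

end IsMeroStem

end MeroStem

section StemGerm

variable {A : Type*} [NormedNonAssocRing A] [NormedSpace ℝ A] [StarRing A]
  {Ω : Set A} {D D' : Set ℂ} {F G : ℂ → Cplx A} {f : A → A}

theorem Induces.congr (h : Induces Ω D F f) (e : ∀ z ∈ D, G z = F z) : Induces Ω D G f :=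
  ⟨h.1, ⟨h.2.1.1, h.2.1.2.1, fun z hz => by
    rw [e z hz, e _ (h.2.1.2.1 z hz), h.2.1.2.2 z hz]⟩, fun z hz J hJ => by
    rw [e z hz, h.2.2 z hz J hJ]⟩

theorem Induces.restrict (h : Induces Ω D F f) (hsub : D' ⊆ D) (hconj : ConjInvariant D')
    (hne : D'.Nonempty) : Induces (circularization D') D' F f :=
  ⟨rfl, ⟨hne, hconj, fun z hz => h.2.1.2.2 z (hsub hz)⟩, fun z hz => h.2.2 z (hsub hz)⟩

variable [IsScalarTower ℝ A A] [SMulCommClass ℝ A A] [StarModule ℝ A] [Nontrivial A]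

theorem Induces.shadow_eq (hS : (imagUnits A).Nonempty) (h : Induces Ω D F f) : shadow Ω = D :=
  h.1 ▸ shadow_circularization hS h.2.1.2.1

variable {J : A}

theorem Induces.stemOf (hA : IsAlternative A) (hJ : J ∈ imagUnits A) (h : Induces Ω D F f) :
    Induces Ω (shadow Ω) (stemOf J f) f := by
  rw [h.shadow_eq ⟨J, hJ⟩]
  exact h.congr fun z hz => h.eq_stemOf hA hJ hz

namespace SemiregularRep

theorem induces (hA : IsAlternative A) (hJ : J ∈ imagUnits A) (f : SemiregularRep Ω) :
    Induces f.dom (shadow f.dom) (stemOf J f.toFun) f.toFun := by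
  obtain ⟨-, D, F, hF, -, -⟩ := f.regular
  exact hF.stemOf hA hJ

theorem isPole_or_isRemovable (hΩ : IsCircular Ω) (f : SemiregularRep Ω) {z : ℂ}
    (hz : z ∈ shadow Ω) (hz' : z ∉ shadow f.dom) (hJ : J ∈ imagUnits A) :
    IsPole f.dom f.toFun (toSlice J z) ∨ IsRemovable f.dom f.toFun (toSlice J z) :=
  f.sing _ ⟨(hΩ.toSlice_mem hJ).2 hz, fun h => hz' ⟨J, hJ, h⟩⟩

theorem eventually_mem_shadow (hJ : J ∈ imagUnits A) (hΩ : IsCircular Ω) (f : SemiregularRep Ω)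
    {z : ℂ} (hz : z ∈ shadow Ω) : ∀ᶠ w in 𝓝[≠] z, w ∈ shadow f.dom := by
  by_cases h : z ∈ shadow f.dom
  · exact nhdsWithin_le_nhds (f.regular.1.isOpen_shadow.mem_nhds h)
  · have sing : IsSingularity f.dom (toSlice J z) :=
      (f.isPole_or_isRemovable hΩ hz h hJ).elim And.left And.left
    exact (sing.eventually hJ).mono fun w hw => ⟨J, hJ, hw⟩

end SemiregularRep

variable [FiniteDimensional ℝ A]

theorem IsSliceRegular.isHolAt_stemOf (hA : IsAlternative A) (hJ : J ∈ imagUnits A)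
    (h : IsSliceRegular Ω f) {z : ℂ} (hz : z ∈ shadow Ω) : IsHolAt (SliceAlg.stemOf J f) z := by
  obtain ⟨isOpen_Ω, D, F, hF, hC1, hdbar⟩ := h
  have isOpen_D : IsOpen D := hF.shadow_eq ⟨J, hJ⟩ ▸ isOpen_Ω.isOpen_shadow
  rw [hF.shadow_eq ⟨J, hJ⟩] at hz
  refine (hC1.isHolAt isOpen_D hdbar hz).congr ?_
  filter_upwards [isOpen_D.mem_nhds hz] with w hw using (hF.eq_stemOf hA hJ hw).symm

namespace SemiregularRep

theorem isMeroStem (hA : IsAlternative A) (hN : NormCompatible A) (hJ : J ∈ imagUnits A)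
    (hΩ : IsCircular Ω) (f : SemiregularRep Ω) :
    IsMeroStem (shadow Ω) (shadow f.dom) (stemOf J f.toFun) where
  isOpen := f.regular.1.isOpen_shadow
  subset := shadow_mono f.dom_subset
  mem_codiscreteWithin := mem_codiscreteWithin_iff_forall_mem_nhdsNE.2 fun _ hz =>
    mem_of_superset (f.eventually_mem_shadow hJ hΩ hz) subset_union_left
  isStem := (f.induces hA hJ).2.1
  isHolAt _ hz := f.regular.isHolAt_stemOf hA hJ hz
  isMeroAt z hz := by
    by_cases h : z ∈ shadow f.dom
    · exact (f.regular.isHolAt_stemOf hA hJ h).isMeroAt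
    · exact (f.induces hA hJ).isMeroAt hA hN hJ (f.eventually_mem_shadow hJ hΩ hz)
        fun K hK => f.isPole_or_isRemovable hΩ hz h hK

end SemiregularRep

/-- The germ of the stem function of a semiregular function on `Ω`, two functions having the same
germ if they agree off a discrete subset of the shadow of `Ω`. -/
noncomputable def stemGerm (J : A) (x : Semiregular Ω) :
    Germ (codiscreteWithin (shadow Ω)) (Cplx A) :=
  (stemOf J (Quotient.out x).toFun : ℂ → Cplx A)

theorem stemGerm_toSemiregular (hA : IsAlternative A) (hN : NormCompatible A)
    (hJ : J ∈ imagUnits A) (hΩ : IsCircular Ω) (f : SemiregularRep Ω) :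
    stemGerm J f.toSemiregular = (stemOf J f.toFun : ℂ → Cplx A) := by
  have eqOn : EqOn (Quotient.out f.toSemiregular).toFun f.toFun
      ((Quotient.out f.toSemiregular).dom ∩ f.dom) := Quotient.mk_out (s := semiregularSetoid Ω) f
  rw [stemGerm]
  generalize Quotient.out f.toSemiregular = g at eqOn ⊢
  have value_eq (w : ℂ) (hg : w ∈ shadow g.dom) (hf : w ∈ shadow f.dom) :
      g.toFun (toSlice J w) = f.toFun (toSlice J w) :=
    eqOn ⟨(g.circular.toSlice_mem hJ).2 hg, (f.circular.toSlice_mem hJ).2 hf⟩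
  refine Germ.coe_eq.2 ?_
  filter_upwards [(f.isMeroStem hA hN hJ hΩ).mem_codiscreteWithin,
    (g.isMeroStem hA hN hJ hΩ).mem_codiscreteWithin] with z hf hg
  rw [stemOf, stemOf, value_eq z hg hf,
    value_eq _ (conjInvariant_shadow _ _ hg) (conjInvariant_shadow _ _ hf)]

theorem stemGerm_injective (hA : IsAlternative A) (hN : NormCompatible A)
    (hJ : J ∈ imagUnits A) (hΩ : IsCircular Ω) (hΩo : IsOpenInCone Ω) :
    Function.Injective (stemGerm J : Semiregular Ω → _) := by
  refine fun x y => Quotient.inductionOn₂ x y fun f g e => Quotient.sound fun x hx => ?_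
  have germ_eq : (stemOf J f.toFun : Germ (codiscreteWithin (shadow Ω)) (Cplx A)) =
      (stemOf J g.toFun : ℂ → Cplx A) := by
    rw [← stemGerm_toSemiregular hA hN hJ hΩ, ← stemGerm_toSemiregular hA hN hJ hΩ]
    exact e
  rw [← f.circular.circularization_shadow_inter g.circular] at hx
  obtain ⟨-, z, ⟨hf, hg⟩, K, hK, rfl⟩ := hx
  rw [(f.induces hA hJ).2.2 z hf K hK, (g.induces hA hJ).2.2 z hg K hK,
    (f.regular.isHolAt_stemOf hA hJ hf).eq_of_eventually_nhdsNE
      (g.regular.isHolAt_stemOf hA hJ hg)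
      ((eventually_codiscreteWithin_iff hΩo.isOpen_shadow).1 (Germ.coe_eq.1 germ_eq) z
        (shadow_mono f.dom_subset hf))]

theorem IsMeroStem.exists_semiregularRep (hA : IsAlternative A) (hN : NormCompatible A)
    (hJ : J ∈ imagUnits A) (hΩ : IsCircular Ω) (hΩo : IsOpenInCone Ω)
    (h : IsMeroStem (shadow Ω) D F) :
    ∃ f : SemiregularRep Ω, f.dom = circularization D ∧ Induces f.dom D F f.toFun ∧
      stemGerm J f.toSemiregular = (F : ℂ → Cplx A) := by
  obtain ⟨f, hf⟩ := h.isStem.exists_induces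
  let rep : SemiregularRep Ω :=
    { dom := circularization D
      toFun := f
      dom_subset := by
        rintro x ⟨-, z, hz, K, hK, rfl⟩
        exact (hΩ.toSlice_mem hK).2 (h.subset hz)
      circular := ⟨D, rfl⟩
      regular := ⟨isOpenInCone_circularization ⟨J, hJ⟩ hN h.isOpen h.isStem.2.1, D, F, hf,
        isC1_of_isHolAt h.isHolAt, fun z hz => dbar_eq_zero_of_isHolAt h.isOpen h.isHolAt hz⟩
      sing := by
        rintro y ⟨hy, -⟩
        rw [← hΩ.circularization_shadow] at hy
        obtain ⟨-, z, hz, K, hK, rfl⟩ := hy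
        have eventually_mem :=
          (eventually_codiscreteWithin_iff hΩo.isOpen_shadow).1 h.mem_codiscreteWithin z hz
        exact Or.inl ((h.isMeroAt z hz).isPole hA hN hK hf eventually_mem) }
  refine ⟨rep, rfl, hf, (stemGerm_toSemiregular hA hN hJ hΩ rep).trans (Germ.coe_eq.2 ?_)⟩
  filter_upwards [h.mem_codiscreteWithin] with z hz using hf.eq_stemOf hA hJ hz

end StemGerm

/-! ## Operations on semiregular functions -/

section Induces

variable {A : Type*} [NormedNonAssocRing A] [NormedSpace ℝ A] [StarRing A]
  {Ω : Set A} {D : Set ℂ} {F G : ℂ → Cplx A} {f g h : A → A}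

theorem Induces.apply_add (hf : Induces Ω D F f) (hg : Induces Ω D G g)
    (hh : Induces Ω D (fun z => F z + G z) h) : ∀ x ∈ Ω, h x = f x + g x := by
  rw [hf.1]
  rintro _ ⟨-, z, hz, J, hJ, rfl⟩
  rw [hh.2.2 z hz J hJ, hf.2.2 z hz J hJ, hg.2.2 z hz J hJ, evalAt_add]

theorem Induces.apply_smul [SMulCommClass ℝ A A] {r : ℝ} (hf : Induces Ω D F f)
    (hh : Induces Ω D (fun z => r • F z) h) : ∀ x ∈ Ω, h x = r • f x := by
  rw [hf.1]
  rintro _ ⟨-, z, hz, J, hJ, rfl⟩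
  rw [hh.2.2 z hz J hJ, hf.2.2 z hz J hJ, evalAt_smul]

theorem Induces.apply_ofAlg {a : A} (hh : Induces Ω D (fun _ => Cplx.ofAlg a) h) :
    ∀ x ∈ Ω, h x = a := by
  rw [hh.1]
  rintro _ ⟨-, z, hz, J, hJ, rfl⟩
  rw [hh.2.2 z hz J hJ, evalAt_ofAlg]

end Induces

variable {A : Type*} [NormedNonAssocRing A] [NormedSpace ℝ A] [StarRing A]
  [IsScalarTower ℝ A A] [SMulCommClass ℝ A A] [StarModule ℝ A] [FiniteDimensional ℝ A]
  [Nontrivial A] {Ω : Set A} {J : A}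

namespace SemiregularRep

theorem exists_add (hA : IsAlternative A) (hN : NormCompatible A) (hJ : J ∈ imagUnits A)
    (hΩ : IsCircular Ω) (hΩo : IsOpenInCone Ω) (f g : SemiregularRep Ω) :
    ∃ h : SemiregularRep Ω, h.dom = f.dom ∩ g.dom ∧
      (∀ x ∈ h.dom, h.toFun x = f.toFun x + g.toFun x) ∧
      stemGerm J h.toSemiregular = stemGerm J f.toSemiregular + stemGerm J g.toSemiregular := by
  have add := (f.isMeroStem hA hN hJ hΩ).add hΩo.isOpen_shadow (g.isMeroStem hA hN hJ hΩ)
  obtain ⟨h, dom_eq, hh, germ_eq⟩ := add.exists_semiregularRep hA hN hJ hΩ hΩo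
  rw [dom_eq] at hh
  refine ⟨h, dom_eq.trans (f.circular.circularization_shadow_inter g.circular), ?_, ?_⟩
  · rw [dom_eq]
    exact ((f.induces hA hJ).restrict inter_subset_left add.isStem.2.1 add.isStem.1).apply_add
      ((g.induces hA hJ).restrict inter_subset_right add.isStem.2.1 add.isStem.1) hh
  · rw [germ_eq, stemGerm_toSemiregular hA hN hJ hΩ, stemGerm_toSemiregular hA hN hJ hΩ]
    rfl

theorem exists_mul (hA : IsAlternative A) (hN : NormCompatible A) (hJ : J ∈ imagUnits A)
    (hΩ : IsCircular Ω) (hΩo : IsOpenInCone Ω) (f g : SemiregularRep Ω) :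
    ∃ h : SemiregularRep Ω, h.dom = f.dom ∩ g.dom ∧
      IsSliceProduct h.dom f.toFun g.toFun h.toFun ∧
      stemGerm J h.toSemiregular = stemGerm J f.toSemiregular * stemGerm J g.toSemiregular := by
  have mul := (f.isMeroStem hA hN hJ hΩ).mul hΩo.isOpen_shadow (g.isMeroStem hA hN hJ hΩ)
  obtain ⟨h, dom_eq, hh, germ_eq⟩ := mul.exists_semiregularRep hA hN hJ hΩ hΩo
  refine ⟨h, dom_eq.trans (f.circular.circularization_shadow_inter g.circular),
    ⟨_, _, _, ?_, ?_, hh⟩, ?_⟩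
  · rw [dom_eq]
    exact (f.induces hA hJ).restrict inter_subset_left mul.isStem.2.1 mul.isStem.1
  · rw [dom_eq]
    exact (g.induces hA hJ).restrict inter_subset_right mul.isStem.2.1 mul.isStem.1
  · rw [germ_eq, stemGerm_toSemiregular hA hN hJ hΩ, stemGerm_toSemiregular hA hN hJ hΩ]
    rfl

theorem exists_star (hA : IsAlternative A) (hN : NormCompatible A) (hJ : J ∈ imagUnits A)
    (hΩ : IsCircular Ω) (hΩo : IsOpenInCone Ω) (f : SemiregularRep Ω) :
    ∃ h : SemiregularRep Ω, h.dom = f.dom ∧ IsSliceConj h.dom f.toFun h.toFun ∧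
      stemGerm J h.toSemiregular = star (stemGerm J f.toSemiregular) := by
  obtain ⟨h, dom_eq, hh, germ_eq⟩ :=
    (f.isMeroStem hA hN hJ hΩ).star.exists_semiregularRep hA hN hJ hΩ hΩo
  rw [f.circular.circularization_shadow] at dom_eq
  refine ⟨h, dom_eq, ⟨_, _, dom_eq ▸ f.induces hA hJ, hh⟩, ?_⟩
  rw [germ_eq, stemGerm_toSemiregular hA hN hJ hΩ]
  rfl

theorem exists_smul (hA : IsAlternative A) (hN : NormCompatible A) (hJ : J ∈ imagUnits A)
    (hΩ : IsCircular Ω) (hΩo : IsOpenInCone Ω) (r : ℝ) (f : SemiregularRep Ω) :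
    ∃ h : SemiregularRep Ω, h.dom = f.dom ∧ (∀ x ∈ h.dom, h.toFun x = r • f.toFun x) ∧
      stemGerm J h.toSemiregular = r • stemGerm J f.toSemiregular := by
  obtain ⟨h, dom_eq, hh, germ_eq⟩ :=
    ((f.isMeroStem hA hN hJ hΩ).smul r).exists_semiregularRep hA hN hJ hΩ hΩo
  rw [f.circular.circularization_shadow] at dom_eq
  refine ⟨h, dom_eq, (dom_eq ▸ f.induces hA hJ : Induces h.dom _ _ _).apply_smul hh, ?_⟩
  rw [germ_eq, stemGerm_toSemiregular hA hN hJ hΩ]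
  rfl

theorem exists_const (hA : IsAlternative A) (hN : NormCompatible A) (hJ : J ∈ imagUnits A)
    (hΩne : Ω.Nonempty) (hΩ : IsCircular Ω) (hΩo : IsOpenInCone Ω) (a : A) :
    ∃ h : SemiregularRep Ω, h.dom = Ω ∧ (∀ x ∈ Ω, h.toFun x = a) ∧
      stemGerm J h.toSemiregular = ((fun _ => Cplx.ofAlg a : ℂ → Cplx A) : Germ _ _) := by
  obtain ⟨h, dom_eq, hh, germ_eq⟩ := (isMeroStem_ofAlg hΩo.isOpen_shadow
    (hΩ.shadow_nonempty hΩne) (conjInvariant_shadow Ω) a).exists_semiregularRep hA hN hJ hΩ hΩo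
  rw [hΩ.circularization_shadow] at dom_eq
  exact ⟨h, dom_eq, (dom_eq ▸ hh).apply_ofAlg, germ_eq⟩

end SemiregularRep

theorem exists_starAlgebra_semiregular (hA : IsAlternative A) (hN : NormCompatible A)
    (hJ : J ∈ imagUnits A) (hΩne : Ω.Nonempty) (hΩ : IsCircular Ω) (hΩo : IsOpenInCone Ω) :
    ∃ (_ : NonAssocRing (Semiregular Ω)) (_ : Module ℝ (Semiregular Ω))
      (_ : StarRing (Semiregular Ω))
      (φ : Semiregular Ω →⋆ₙₐ[ℝ] Germ (codiscreteWithin (shadow Ω)) (Cplx A)),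
      ⇑φ = stemGerm J ∧ φ 1 = 1 := by
  have surj : Function.Surjective (SemiregularRep.toSemiregular (Ω := Ω)) := Quotient.exists_rep
  refine exists_starAlgebra_of_injective _ (stemGerm_injective hA hN hJ hΩ hΩo)
    ?_ (surj.forall₂.2 fun f g => ?_) (surj.forall₂.2 fun f g => ?_) (surj.forall.2 fun f => ?_)
    fun r => surj.forall.2 fun f => ?_
  · obtain ⟨h, -, -, germ_eq⟩ := SemiregularRep.exists_const hA hN hJ hΩne hΩ hΩo 1
    exact ⟨_, germ_eq⟩
  · obtain ⟨h, -, -, germ_eq⟩ := f.exists_add hA hN hJ hΩ hΩo g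
    exact ⟨_, germ_eq⟩
  · obtain ⟨h, -, -, germ_eq⟩ := f.exists_mul hA hN hJ hΩ hΩo g
    exact ⟨_, germ_eq⟩
  · obtain ⟨h, -, -, germ_eq⟩ := f.exists_star hA hN hJ hΩ hΩo
    exact ⟨_, germ_eq⟩
  · obtain ⟨h, -, -, germ_eq⟩ := f.exists_smul hA hN hJ hΩ hΩo r
    exact ⟨_, germ_eq⟩

/-! ## Nonsingularity -/

section Components

theorem eventually_mem_connectedComponentIn_iff {X : Type*} [TopologicalSpace X]
    [LocallyConnectedSpace X] {U : Set X} (hU : IsOpen U) (z₀ : X) {z : X} (hz : z ∈ U) :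
    ∀ᶠ w in 𝓝 z, (w ∈ connectedComponentIn U z₀ ↔ z ∈ connectedComponentIn U z₀) := by
  have mem_iff {v : X} (hv : v ∈ U) : v ∈ connectedComponentIn U z₀ ↔
      connectedComponentIn U z₀ = connectedComponentIn U v :=
    ⟨connectedComponentIn_eq, fun e => e ▸ mem_connectedComponentIn hv⟩
  filter_upwards [hU.connectedComponentIn.mem_nhds (mem_connectedComponentIn hz)] with w hw
  rw [mem_iff (connectedComponentIn_subset _ _ hw), mem_iff hz, connectedComponentIn_eq hw]

theorem star_notMem_of_isPreconnected {C : Set ℂ} (hC : IsPreconnected C)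
    (hreal : ∀ r : ℝ, (r : ℂ) ∉ C) {z : ℂ} (hz : z ∈ C) : star z ∉ C := fun hz' => by
  have zero_mem : (0 : ℝ) ∈ uIcc z.im (-z.im) := by
    rcases le_total 0 z.im with h | h
    · exact mem_uIcc.2 (Or.inr ⟨neg_nonpos.2 h, h⟩)
    · exact mem_uIcc.2 (Or.inl ⟨h, neg_nonneg.2 h⟩)
  obtain ⟨w, hw, im_eq⟩ := (hC.image _ Complex.continuous_im.continuousOn).ordConnected.uIcc_subset
    (mem_image_of_mem _ hz) (mem_image_of_mem _ hz') zero_mem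
  exact hreal w.re (by rwa [show (w.re : ℂ) = w from Complex.ext rfl im_eq.symm])

theorem conjInvariant_connectedComponentIn {U : Set ℂ} (hU : ConjInvariant U) {z : ℂ} {r : ℝ}
    (hr : (r : ℂ) ∈ connectedComponentIn U z) : ConjInvariant (connectedComponentIn U z) := by
  rw [connectedComponentIn_eq hr]
  intro w hw
  have r_mem : (r : ℂ) ∈ star '' connectedComponentIn U r :=
    ⟨r, mem_connectedComponentIn (connectedComponentIn_subset _ _ hr), Complex.conj_ofReal r⟩
  refine (isPreconnected_connectedComponentIn.image star
    continuous_star.continuousOn).subset_connectedComponentIn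
    r_mem ?_ ⟨w, hw, rfl⟩
  rintro _ ⟨v, hv, rfl⟩
  exact hU v (connectedComponentIn_subset _ _ hv)

variable {A : Type*} [NormedNonAssocRing A] [NormedSpace ℝ A] [StarRing A]
  [IsScalarTower ℝ A A] [SMulCommClass ℝ A A] [StarModule ℝ A] [FiniteDimensional ℝ A]
  [Nontrivial A] {Ω : Set A}

theorem isUnionOfSliceDomains_iff (hS : (imagUnits A).Nonempty) (hN : NormCompatible A)
    (hΩ : IsCircular Ω) (hΩo : IsOpenInCone Ω) :
    IsUnionOfSliceDomains Ω ↔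
      ∀ z ∈ shadow Ω, ∃ r : ℝ, (r : ℂ) ∈ connectedComponentIn (shadow Ω) z := by
  constructor
  · rintro ⟨S, hS, rfl⟩ z ⟨J, hJ, s, hs, hz⟩
    obtain ⟨-, D, -, connected, conj, ⟨r, hr⟩, rfl⟩ := hS s hs
    refine ⟨r, connected.isPreconnected.subset_connectedComponentIn
      ((toSlice_mem_circularization hJ conj).1 hz) (fun w hw => ?_) hr⟩
    exact ⟨J, hJ, _, hs, toSlice_mem_circularization_of_mem hJ hw⟩
  · intro h
    have isOpen (z : ℂ) : IsOpen (connectedComponentIn (shadow Ω) z) :=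
      hΩo.isOpen_shadow.connectedComponentIn
    refine ⟨(fun z => circularization (connectedComponentIn (shadow Ω) z)) '' shadow Ω, ?_,
      subset_antisymm (fun x hx => ?_) (sUnion_subset ?_)⟩
    · rintro _ ⟨z, hz, rfl⟩
      obtain ⟨r, hr⟩ := h z hz
      have conj := conjInvariant_connectedComponentIn (conjInvariant_shadow Ω) hr
      exact ⟨isOpenInCone_circularization hS hN (isOpen z) conj, _, isOpen z,
        isConnected_connectedComponentIn_iff.2 hz, conj, ⟨r, hr⟩, rfl⟩
    · rw [← hΩ.circularization_shadow] at hx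
      obtain ⟨-, z, hz, J, hJ, rfl⟩ := hx
      exact ⟨_, ⟨z, hz, rfl⟩,
        toSlice_mem_circularization_of_mem hJ (mem_connectedComponentIn hz)⟩
    · rintro _ ⟨z, -, rfl⟩ _ ⟨-, w, hw, J, hJ, rfl⟩
      exact (hΩ.toSlice_mem hJ).2 (connectedComponentIn_subset _ _ hw)

end Components

section IdentityPrinciple

variable {A : Type*} [NormedNonAssocRing A] [NormedSpace ℝ A] [FiniteDimensional ℝ A]
  {F : ℂ → Cplx A} {U : Set ℂ}

theorem eventually_eq_zero_of_frequently (hU : IsPreconnected U) (hF : ∀ z ∈ U, IsMeroAt F z)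
    {u z : ℂ} (hu : u ∈ U) (h : ∃ᶠ w in 𝓝[≠] u, F w = 0) (hz : z ∈ U) :
    ∀ᶠ w in 𝓝[≠] z, F w = 0 := by
  let b := Module.finBasis ℝ A
  have coord_eq (i) : ∀ᶠ w in 𝓝[≠] z, Cplx.coord (b.coord i) (F w) = 0 := by
    have mero : MeromorphicOn (fun w => Cplx.coord (b.coord i) (F w)) U := fun w hw => hF w hw _
    rw [← meromorphicOrderAt_eq_top_iff]
    by_contra order_ne
    refine mero.meromorphicOrderAt_ne_top_of_isPreconnected hU hz hu order_ne ?_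
    rw [meromorphicOrderAt_eq_top_iff]
    exact (mero u hu).frequently_zero_iff_eventuallyEq_zero.1
      (h.mono fun w hw => by rw [hw, map_zero])
  filter_upwards [eventually_all.2 coord_eq] with w hw
  ext
  · exact b.ext_elem fun i => by simpa using congrArg Complex.re (hw i)
  · exact b.ext_elem fun i => by simpa using congrArg Complex.im (hw i)

end IdentityPrinciple

section NullStem

variable {A : Type*} [NormedNonAssocRing A] {J : A} {C U : Set ℂ}

open Classical in
/-- The stem function equal to `1 + ıJ` on `C`, to `1 - ıJ` on the conjugate of `C` and to `0`
elsewhere. It is the standard stem function of norm zero on a domain that has a component missing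
the real line. -/
noncomputable def nullStem (J : A) (C : Set ℂ) (z : ℂ) : Cplx A :=
  if z ∈ C then ⟨1, J⟩ else if star z ∈ C then ⟨1, -J⟩ else 0

theorem nullStem_ne_zero [Nontrivial A] {z : ℂ} (hz : z ∈ C) : nullStem J C z ≠ 0 := by
  rw [nullStem, if_pos hz]
  exact fun h => one_ne_zero (congrArg Cplx.re h)

theorem nullStem_star (hC : ∀ z ∈ C, star z ∉ C) (z : ℂ) :
    nullStem J C (star z) = (nullStem J C z).conj := by
  have := hC z
  ext <;> by_cases h : z ∈ C <;> by_cases h' : star z ∈ C <;> simp_all [nullStem]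

variable [NormedSpace ℝ A]

theorem isHolAt_nullStem {z : ℂ} (h : ∀ᶠ w in 𝓝 z, (w ∈ C ↔ z ∈ C))
    (h' : ∀ᶠ w in 𝓝 (star z), (w ∈ C ↔ star z ∈ C)) : IsHolAt (nullStem J C) z := by
  refine (isHolAt_const (nullStem J C z) z).congr ?_
  filter_upwards [h, continuous_star.continuousAt.eventually h'] with w hw hw'
  classical
  exact if_congr hw.symm rfl (if_congr hw'.symm rfl rfl)

theorem isMeroStem_nullStem (hU : IsOpen U) (hconj : ConjInvariant U) {z : ℂ} (hz : z ∈ U)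
    (hreal : ∀ r : ℝ, (r : ℂ) ∉ connectedComponentIn U z) :
    IsMeroStem U U (nullStem J (connectedComponentIn U z)) := by
  refine isMeroStem_of_isHolAt hU ⟨⟨z, hz⟩, hconj, fun w _ => nullStem_star (fun v hv =>
    star_notMem_of_isPreconnected isPreconnected_connectedComponentIn hreal hv) w⟩ fun w hw => ?_
  exact isHolAt_nullStem (eventually_mem_connectedComponentIn_iff hU z hw)
    (eventually_mem_connectedComponentIn_iff hU z (hconj w hw))

theorem nullStem_mul_star [StarRing A] (hJ : J ∈ imagUnits A) (z : ℂ) :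
    nullStem J C z * star (nullStem J C z) = 0 := by
  unfold nullStem
  split_ifs <;> ext <;> simp [star_imagUnit hJ, imagUnit_mul_self hJ]

end NullStem

section NormZero

variable {A : Type*} [NormedNonAssocRing A] [NormedSpace ℝ A] [StarRing A]
  {F : ℂ → Cplx A} {U D : Set ℂ}

theorem IsMeroStem.frequently_eq_zero (hA : IsNonsingular A) (hU : IsOpen U)
    (hF : IsMeroStem U D F)
    (h : ∀ᶠ z in codiscreteWithin U, F z * star (F z) = 0) {r : ℝ} (hr : (r : ℂ) ∈ U) :
    ∃ᶠ z in 𝓝[≠] (r : ℂ), F z = 0 := by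
  have tendsto_ofReal : Tendsto ((↑) : ℝ → ℂ) (𝓝[≠] r) (𝓝[≠] (r : ℂ)) :=
    Complex.continuous_ofReal.continuousAt.continuousWithinAt.tendsto_nhdsWithin
      fun t ht e => ht (Complex.ofReal_injective e)
  have near := (eventually_codiscreteWithin_iff hU).1
    (h.and hF.mem_codiscreteWithin) r hr
  refine tendsto_ofReal.frequently (Eventually.frequently ?_)
  filter_upwards [tendsto_ofReal.eventually near] with t ⟨norm_eq, ht⟩
  have im_eq : (F t).im = 0 := hF.isStem.im_eq_zero ht (Complex.ofReal_im t)
  have re_eq : (F t).re * star (F t).re = 0 := by simpa [im_eq] using congrArg Cplx.re norm_eq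
  exact Cplx.ext (hA _ re_eq) im_eq

variable {J : A} [FiniteDimensional ℝ A] [Nontrivial A]

theorem forall_isMeroStem_eq_zero_iff (hJ : J ∈ imagUnits A) (hU : IsOpen U) (hne : U.Nonempty)
    (hconj : ConjInvariant U) :
    (∀ (D : Set ℂ) (F : ℂ → Cplx A), IsMeroStem U D F →
      (∀ᶠ z in codiscreteWithin U, F z * star (F z) = 0) →
        ∀ᶠ z in codiscreteWithin U, F z = 0) ↔
    IsNonsingular A ∧ ∀ z ∈ U, ∃ r : ℝ, (r : ℂ) ∈ connectedComponentIn U z := by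
  refine ⟨fun h => ⟨fun a ha => ?_, fun z hz => ?_⟩, fun ⟨hA, hreal⟩ _ F hF h => ?_⟩
  · have := neBot_codiscreteWithin hU hne
    have norm_eq : Cplx.ofAlg a * star (Cplx.ofAlg a) = 0 := by ext <;> simp [ha]
    obtain ⟨_, hz⟩ :=
      (h U _ (isMeroStem_ofAlg hU hne hconj a) (Eventually.of_forall fun _ => norm_eq)).exists
    exact congrArg Cplx.re hz
  · by_contra! hreal
    have eventually_zero := (eventually_codiscreteWithin_iff hU).1
      (h U _ (isMeroStem_nullStem hU hconj hz hreal)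
        (Eventually.of_forall (nullStem_mul_star hJ))) z hz
    obtain ⟨w, hw, hw'⟩ := (eventually_zero.and (nhdsWithin_le_nhds
      (hU.connectedComponentIn.mem_nhds (mem_connectedComponentIn hz)))).exists
    exact nullStem_ne_zero hw' hw
  · refine (eventually_codiscreteWithin_iff hU).2 fun z hz => ?_
    obtain ⟨r, hr⟩ := hreal z hz
    exact eventually_eq_zero_of_frequently isPreconnected_connectedComponentIn
      (fun w hw => hF.isMeroAt w (connectedComponentIn_subset _ _ hw)) hr
      (hF.frequently_eq_zero hA hU h (connectedComponentIn_subset _ _ hr))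
      (mem_connectedComponentIn hz)

end NormZero

variable {A : Type*} [NormedNonAssocRing A] [NormedSpace ℝ A] [StarRing A]
  [IsScalarTower ℝ A A] [SMulCommClass ℝ A A] [StarModule ℝ A] [FiniteDimensional ℝ A]
  [Nontrivial A] {Ω : Set A} {J : A}

theorem stemGerm_forall_iff (hA : IsAlternative A) (hN : NormCompatible A)
    (hJ : J ∈ imagUnits A) (hΩ : IsCircular Ω) (hΩo : IsOpenInCone Ω)
    {p : Germ (codiscreteWithin (shadow Ω)) (Cplx A) → Prop} :
    (∀ x, p (stemGerm J x)) ↔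
      ∀ (D : Set ℂ) (F : ℂ → Cplx A), IsMeroStem (shadow Ω) D F → p F := by
  refine ⟨fun h D F hF => ?_, fun h => Quotient.ind fun f => ?_⟩
  · obtain ⟨f, -, -, germ_eq⟩ := hF.exists_semiregularRep hA hN hJ hΩ hΩo
    exact germ_eq ▸ h f.toSemiregular
  · exact (stemGerm_toSemiregular hA hN hJ hΩ f) ▸ h _ _ (f.isMeroStem hA hN hJ hΩ)

theorem stemGerm_nonsingular_iff (hA : IsAlternative A) (hN : NormCompatible A)
    (hJ : J ∈ imagUnits A) (hΩne : Ω.Nonempty) (hΩ : IsCircular Ω) (hΩo : IsOpenInCone Ω) :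
    (∀ x : Semiregular Ω, stemGerm J x * star (stemGerm J x) = 0 → stemGerm J x = 0) ↔
      IsNonsingular A ∧ IsUnionOfSliceDomains Ω := by
  rw [isUnionOfSliceDomains_iff ⟨J, hJ⟩ hN hΩ hΩo, ← forall_isMeroStem_eq_zero_iff hJ
    hΩo.isOpen_shadow (hΩ.shadow_nonempty hΩne) (conjInvariant_shadow Ω),
    stemGerm_forall_iff hA hN hJ hΩ hΩo (p := fun x => x * star x = 0 → x = 0)]
  exact forall₃_congr fun D F _ => imp_congr Germ.coe_eq Germ.coe_eq

end SliceAlg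

theorem mainTheorem5 {A : Type*} [NormedNonAssocRing A] [NormedSpace ℝ A] [IsScalarTower ℝ A A]
    [SMulCommClass ℝ A A] [StarRing A] [StarModule ℝ A] [FiniteDimensional ℝ A] [Nontrivial A]
    (hA : IsAlternative A) (hS : (SliceAlg.imagUnits A).Nonempty)
    (hN : SliceAlg.NormCompatible A)
    (Ω : Set A) (hΩne : Ω.Nonempty) (hΩc : SliceAlg.IsCircular Ω)
    (hΩo : SliceAlg.IsOpenInCone Ω) :
    ∃ (_ : NonAssocRing (SliceAlg.Semiregular Ω)) (_ : Module ℝ (SliceAlg.Semiregular Ω))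
      (_ : StarRing (SliceAlg.Semiregular Ω)),
      -- the operations are the expected ones, and all of them preserve semiregularity
      (∀ f g : SliceAlg.SemiregularRep Ω, ∃ h : SliceAlg.SemiregularRep Ω,
        h.dom = f.dom ∩ g.dom ∧ (∀ x ∈ h.dom, h.toFun x = f.toFun x + g.toFun x) ∧
        f.toSemiregular + g.toSemiregular = h.toSemiregular) ∧
      (∀ f g : SliceAlg.SemiregularRep Ω, ∃ h : SliceAlg.SemiregularRep Ω,
        h.dom = f.dom ∩ g.dom ∧ SliceAlg.IsSliceProduct h.dom f.toFun g.toFun h.toFun ∧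
        f.toSemiregular * g.toSemiregular = h.toSemiregular) ∧
      (∀ f : SliceAlg.SemiregularRep Ω, ∃ h : SliceAlg.SemiregularRep Ω,
        h.dom = f.dom ∧ SliceAlg.IsSliceConj h.dom f.toFun h.toFun ∧
        star f.toSemiregular = h.toSemiregular) ∧
      (∀ (r : ℝ) (f : SliceAlg.SemiregularRep Ω), ∃ h : SliceAlg.SemiregularRep Ω,
        h.dom = f.dom ∧ (∀ x ∈ h.dom, h.toFun x = r • f.toFun x) ∧
        r • f.toSemiregular = h.toSemiregular) ∧
      (∃ e : SliceAlg.SemiregularRep Ω, e.dom = Ω ∧ (∀ x ∈ Ω, e.toFun x = 1) ∧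
        (1 : SliceAlg.Semiregular Ω) = e.toSemiregular) ∧
      -- they form a real alternative algebra with unit `1 ≠ 0`
      IsScalarTower ℝ (SliceAlg.Semiregular Ω) (SliceAlg.Semiregular Ω) ∧
      SMulCommClass ℝ (SliceAlg.Semiregular Ω) (SliceAlg.Semiregular Ω) ∧
      IsAlternative (SliceAlg.Semiregular Ω) ∧
      Nontrivial (SliceAlg.Semiregular Ω) ∧
      -- which is a real *-algebra
      StarModule ℝ (SliceAlg.Semiregular Ω) ∧
      -- nonsingular exactly in the stated case
      (IsNonsingular (SliceAlg.Semiregular Ω) ↔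
        IsNonsingular A ∧ SliceAlg.IsUnionOfSliceDomains Ω) := by
  obtain ⟨J, hJ⟩ := hS
  obtain ⟨instRing, instModule, instStar, φ, coe_φ, φ_one⟩ :=
    SliceAlg.exists_starAlgebra_semiregular hA hN hJ hΩne hΩc hΩo
  have hφ : Function.Injective φ := coe_φ ▸ SliceAlg.stemGerm_injective hA hN hJ hΩc hΩo
  have := SliceAlg.neBot_codiscreteWithin hΩo.isOpen_shadow (hΩc.shadow_nonempty hΩne)
  refine ⟨instRing, instModule, instStar, fun f g => ?_, fun f g => ?_, fun f => ?_,
    fun r f => ?_, ?_, SliceAlg.isScalarTower_of_injective (φ := φ.toNonUnitalAlgHom) hφ,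
    SliceAlg.smulCommClass_of_injective (φ := φ.toNonUnitalAlgHom) hφ,
    .of_injective hφ (SliceAlg.germ_isAlternative (SliceAlg.Cplx.isAlternative hA)),
    ⟨0, 1, fun h => ?_⟩, SliceAlg.starModule_of_injective hφ, ?_⟩
  · obtain ⟨h, dom_eq, apply_eq, germ_eq⟩ := f.exists_add hA hN hJ hΩc hΩo g
    exact ⟨h, dom_eq, apply_eq, hφ (by rw [map_add, coe_φ, germ_eq])⟩
  · obtain ⟨h, dom_eq, isProduct, germ_eq⟩ := f.exists_mul hA hN hJ hΩc hΩo g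
    exact ⟨h, dom_eq, isProduct, hφ (by rw [map_mul, coe_φ, germ_eq])⟩
  · obtain ⟨h, dom_eq, isConj, germ_eq⟩ := f.exists_star hA hN hJ hΩc hΩo
    exact ⟨h, dom_eq, isConj, hφ (by rw [map_star, coe_φ, germ_eq])⟩
  · obtain ⟨h, dom_eq, apply_eq, germ_eq⟩ := f.exists_smul hA hN hJ hΩc hΩo r
    exact ⟨h, dom_eq, apply_eq, hφ (by rw [map_smul, coe_φ, germ_eq])⟩
  · obtain ⟨e, dom_eq, apply_eq, germ_eq⟩ :=
      SliceAlg.SemiregularRep.exists_const hA hN hJ hΩne hΩc hΩo 1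
    exact ⟨e, dom_eq, apply_eq, hφ (by rw [φ_one, coe_φ, germ_eq]; rfl)⟩
  · exact zero_ne_one (by rw [← φ_one, ← h, map_zero])
  · rw [SliceAlg.isNonsingular_iff_of_injective hφ, coe_φ]
    exact SliceAlg.stemGerm_nonsingular_iff hA hN hJ hΩne hΩc hΩo
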